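/- Let $M_2\subseteq\mathbb{Z}$ and let $\mathbb{V}(\mathbb{Z},M_2)$ be the infinite strip of height one with marked points $(i,0)$, $i\in\mathbb{Z}$, on its lower boundary and $(u,1)$, $u\in M_2$, on its upper boundary. An arc is a non-contractible simple curve in the strip joining two marked points, up to isotopy fixing the endpoints, and not isotopic to a boundary segment between two consecutive marked points of one boundary (so an arc is determined by its two endpoints). Two arcs are compatible if they have representatives that do not cross except perhaps at endpoints, i.e. if their endpoints do not interlace on the boundary of the strip. A triangulation $T$ is a maximal collection of pairwise compatible arcs. It is admissible if every marked point $(i,0)$ on the lower boundary is incident to only finitely many arcs of $T$. A marked point is special if it is incident to no arc of $T$. A triangle of $T$ is given by three marked points, any two of which are joined by an arc of $T$ or by a boundary segment. An infinite frieze is a map $t:\mathbb{Z}\times\mathbb{Z}\to\mathbb{Z}$ such that $t(i,i)=0$, $t(i,i+1)=1$, $t(i,j)\ge 1$ for $i<j$, $t(i,j)=-t(j,i)$, and $t(i,j)\,t(i+1,j+1)-t(i,j+1)\,t(i+1,j)=1$ for all $i,j$. Its quiddity sequence is $(t(i-1,i+1))_{i\in\mathbb{Z}}$. For marked points $A,B$,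 the number $CC_T(A,B)$ is the label of $B$ produced as follows: label $A$ by $0$, and every marked point joined to $A$ by an arc of $T$ or a boundary segment by $1$; then, whenever a triangle of $T$ has exactly two labelled vertices, label its third vertex by the sum of their labels. Write $CC_T(i,j)$ for $CC_T((i,0),(j,0))$. For integers $i<j$, let $BCI_T(i,i+1,\dots,j)$ be the number of tuples $(\Delta_{i+1},\dots,\Delta_{j-1})$ of pairwise distinct triangles of $T$ such that $(k,0)$ is a vertex of $\Delta_k$ for every $k$ (so it equals $1$ if $j=i+1$), and let $BCI_T(i)=0$ when $i=j$. **Proposition.** Let $T$ be an admissible triangulation of $\mathbb{V}(\mathbb{Z},M_2)$ with no special marked point on the upper boundary, and for each $i\in\mathbb{Z}$ let $a_i$ be the number of triangles of $T$ incident to $(i,0)$. Then there is a unique infinite frieze $t=\Phi(T)$ with quiddity sequence $(a_i)_{i\in\mathbb{Z}}$, and for all integers $i\le j$ the label $CC_T(i,j)$ is well defined (it is reached after finitely many steps and does not depend on the order of the steps), and $$t(i,j)=CC_T(i,j)=BCI_T(i,i+1,\dots,j).$$ -/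

import Mathlib

namespace Strip

/-! ### Marked points and arcs of the infinite strip -/

/-- The marked points of the infinite strip `𝕍(ℤ, M₂)`: the points `(i, 0)` with `i ∈ ℤ` on the lower
boundary and the points `(u, 1)` with `u ∈ M₂` on the upper boundary.

The linear order (`⊕ₗ` is the lexicographic sum, `ᵒᵈ` the reversed order) is the order in which the
marked points are met when the boundary of the strip is traversed counterclockwise: first the lower
boundary from left to right, then the upper boundary from right to left. -/
abbrev MarkedPoint (M₂ : Set ℤ) : Type := ℤ ⊕ₗ (↥M₂)ᵒᵈ

variable {M₂ : Set ℤ}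

/-- The marked point `(i, 0)`. -/
def lower (i : ℤ) : MarkedPoint M₂ := toLex (Sum.inl i)

/-- The marked point `(u, 1)`. -/
def upper (u : M₂) : MarkedPoint M₂ := toLex (Sum.inr (OrderDual.toDual u))

/-- An arc of the strip. The strip is simply connected, so the isotopy class (fixing endpoints) of a
simple curve between two marked points is determined by its two endpoints; we list them in the
boundary order. The endpoints are distinct (a loop is contractible) and the curve is not isotopic to
a boundary segment between consecutive marked points of one boundary: there is a marked point
strictly between the endpoints. (Nothing is excluded for endpoints on different boundaries: between
`(i, 0)` and `(u, 1)` there is always `(i + 1, 0)`.) -/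
@[ext]
structure Arc (M₂ : Set ℤ) where
  fst : MarkedPoint M₂
  snd : MarkedPoint M₂
  lt : fst < snd
  not_boundary : ¬ fst ⋖ snd

/-- The marked point `p` is an endpoint of the arc `α`. -/
def Arc.Incident (α : Arc M₂) (p : MarkedPoint M₂) : Prop := α.fst = p ∨ α.snd = p

/-- Two arcs cross (that is, all their representatives cross in the interior of the strip) iff their
endpoints interlace on the boundary. -/
def Arc.Crosses (α β : Arc M₂) : Prop :=
  (α.fst < β.fst ∧ β.fst < α.snd ∧ α.snd < β.snd) ∨
    (β.fst < α.fst ∧ α.fst < β.snd ∧ β.snd < α.snd)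

/-- Two arcs are compatible if they do not cross, except maybe at their endpoints. -/
def Arc.Compatible (α β : Arc M₂) : Prop := ¬ α.Crosses β

/-! ### Triangulations -/

/-- A triangulation is a maximal collection of pairwise compatible arcs. -/
def IsTriangulation (T : Set (Arc M₂)) : Prop :=
  Maximal (fun S : Set (Arc M₂) => S.Pairwise Arc.Compatible) T

/-- Every marked point on the lower boundary is incident with only finitely many arcs. -/
def IsAdmissible (T : Set (Arc M₂)) : Prop :=
  ∀ i : ℤ, {α ∈ T | α.Incident (lower i)}.Finite

/-- A marked point is special if it is not incident to any arc of the triangulation. -/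
def IsSpecial (T : Set (Arc M₂)) (p : MarkedPoint M₂) : Prop :=
  ¬ ∃ α ∈ T, α.Incident p

/-- The marked points as vertices; two of them are joined if there is an arc of `T` between them or
they are consecutive on one boundary of the strip (`p ⋖ q`: joined by a boundary segment). -/
def edgeGraph (T : Set (Arc M₂)) : SimpleGraph (MarkedPoint M₂) where
  Adj p q := (∃ α ∈ T, (α.fst = p ∧ α.snd = q) ∨ (α.fst = q ∧ α.snd = p)) ∨ p ⋖ q ∨ q ⋖ p
  symm := ⟨by
    rintro p q (⟨α, hα, h⟩ | h | h)
    · exact Or.inl ⟨α, hα, h.symm⟩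
    · exact Or.inr (Or.inr h)
    · exact Or.inr (Or.inl h)⟩
  loopless := ⟨by
    rintro p (⟨α, -, ⟨h, h'⟩ | ⟨h, h'⟩⟩ | h | h)
    · exact absurd α.lt (by simp [h, h'])
    · exact absurd α.lt (by simp [h, h'])
    · exact lt_irrefl _ h.lt
    · exact lt_irrefl _ h.lt⟩

/-- The triangles of the triangulation, given by their sets of three vertices: any two vertices are
joined by an arc of `T` or by a boundary segment. -/
def triangles (T : Set (Arc M₂)) : Set (Finset (MarkedPoint M₂)) :=
  (edgeGraph T).cliqueSet 3

/-- The triangles incident with the marked point `p`. -/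
def trianglesAt (T : Set (Arc M₂)) (p : MarkedPoint M₂) : Set (Finset (MarkedPoint M₂)) :=
  {Δ ∈ triangles T | p ∈ Δ}

/-- The number `a_i` of triangles incident with `(i, 0)`. -/
noncomputable def numTriangles (T : Set (Arc M₂)) (i : ℤ) : ℕ :=
  (trianglesAt T (lower i)).ncard

/-! ### Infinite friezes -/

/-- Infinite friezes, extended antisymmetrically to the whole plane `ℤ × ℤ`. -/
structure IsInfiniteFrieze (t : ℤ → ℤ → ℤ) : Prop where
  diag : ∀ i, t i i = 0
  pos : ∀ i j, i < j → 1 ≤ t i j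
  one : ∀ i, t i (i + 1) = 1
  antisymm : ∀ i j, t i j = - t j i
  unimodular : ∀ i j, t i j * t (i + 1) (j + 1) - t i (j + 1) * t (i + 1) j = 1

/-- The quiddity sequence of an infinite frieze: the diagonal next to the diagonal of ones. -/
def quiddity (t : ℤ → ℤ → ℤ) (i : ℤ) : ℤ := t (i - 1) (i + 1)

/-- `t = Φ(T)`: `t` is an infinite frieze whose quiddity sequence counts the triangles of `T`
incident with each marked point of the lower boundary. -/
def IsPhi (T : Set (Arc M₂)) (t : ℤ → ℤ → ℤ) : Prop :=
  IsInfiniteFrieze t ∧ ∀ i, quiddity t i = numTriangles T i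

/-! ### Conway–Coxeter counting -/

/-- The first stage of the labelling procedure: `A` is labelled zero and every vertex joined to `A`
by an arc or a boundary segment is labelled one; `none` means that there is no label yet. -/
noncomputable def ccInit (T : Set (Arc M₂)) (A : MarkedPoint M₂) :
    MarkedPoint M₂ → Option ℕ :=
  open Classical in
  fun P => if P = A then some 0 else if (edgeGraph T).Adj A P then some 1 else none

/-- One step of the labelling procedure: some triangle `P, Q, R` has exactly two labelled vertices
`P, Q`, and `R` receives the sum of their labels. -/
def CCStep (T : Set (Arc M₂)) (L L' : MarkedPoint M₂ → Option ℕ) : Prop :=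
  ∃ (P Q R : MarkedPoint M₂) (p q : ℕ), {P, Q, R} ∈ triangles T ∧
    L P = some p ∧ L Q = some q ∧ L R = none ∧ L' = Function.update L R (some (p + q))

/-- The labelling procedure started at `A`, with its steps performed in some order, gives the label
`x` to `B` after finitely many steps. -/
def CCLabel (T : Set (Arc M₂)) (A B : MarkedPoint M₂) (x : ℕ) : Prop :=
  ∃ L, Relation.ReflTransGen (CCStep T) (ccInit T A) L ∧ L B = some x

/-- `CC_T(A, B) = n`: the labelling procedure started at `A` reaches `B`, and, in whatever order its
steps are performed, the label that it gives to `B` is `n`. -/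
def CCEq (T : Set (Arc M₂)) (A B : MarkedPoint M₂) (n : ℤ) : Prop :=
  (∃ x : ℕ, CCLabel T A B x) ∧ ∀ x : ℕ, CCLabel T A B x → (x : ℤ) = n

/-! ### Broline–Crowe–Isaacs counting -/

/-- The `r`-tuples for a walk with interior vertices `P 0, …, P (r - 1)`: tuples of pairwise distinct
triangles of the triangulation, the `k`-th of which has `P k` as a vertex. -/
def bciTuples (T : Set (Arc M₂)) {r : ℕ} (P : Fin r → MarkedPoint M₂) :
    Set (Fin r → Finset (MarkedPoint M₂)) :=
  {f | Function.Injective f ∧ ∀ k, f k ∈ trianglesAt T (P k)}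

/-- `BCI_T(i, i + 1, …, j)` for `i ≤ j`: zero if `i = j`, and otherwise the number of tuples for the
walk with interior vertices `(i + 1, 0), …, (j - 1, 0)`; for `j = i + 1` only the empty tuple is
counted, so the value is one. -/
noncomputable def BCI (T : Set (Arc M₂)) (i j : ℤ) : ℕ :=
  if i = j then 0
  else (bciTuples T (fun k : Fin (j - i - 1).toNat => lower (i + 1 + (k : ℤ)))).ncard

end Strip

/-! Fix `i`. The frieze entries, the Conway–Coxeter labels and the Broline–Crowe–Isaacs numbers, as
functions of `j`, all start with `0, 1` at `j = i, i + 1` and satisfy `x (j + 1) = a_j * x j - x (j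
- 1)` for `j > i`; hence they agree.

For a frieze, unimodularity and positivity give the recurrence (`IsInfiniteFrieze.recurrence`).
Conversely, two independent solutions of the recurrence produce an antisymmetric unimodular array,
whose entries above the diagonal are the labels and therefore positive (`existsUnique_frieze`).

For the two counts the recurrence is a telescoping sum. Arcs and boundary segments form a maximal
noncrossing graph, and a lower vertex has finite degree by admissibility, so the triangles there
form a finite fan from one boundary neighbour to the other (`IsMaximalNoncrossing.sum_fan`). With
labels counted positively beyond the vertex and negatively before it, each triangle of the fan
contributes the label of the vertex (`label_add_label`); that labels are independent of the order of
steps comes from invariants of the procedure (`IsLabelling`).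

For tuples, the triangles under an edge between walk vertices can be assigned to the vertices
strictly below it in exactly one way (`walkCount_edge`). This tells how many shorter tuples avoid a
given triangle at the last vertex, and those corrections telescope too (`walkNumber_recurrence`). -/

/-! ### Cyclic order and maximal noncrossing graphs -/

namespace Strip

section Cyclic

variable {α : Type*} [LinearOrder α]

/-- `a`, `b`, `c` are distinct and met in this order when the boundary is traversed. -/
def Cyc (a b c : α) : Prop := (a < b ∧ b < c) ∨ (b < c ∧ c < a) ∨ (c < a ∧ a < b)

theorem Cyc.rotate {a b c : α} (h : Cyc a b c) : Cyc b c a := by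
  unfold Cyc at *; tauto

theorem Cyc.asymm {a b c : α} (h : Cyc a b c) : ¬ Cyc a c b := by
  unfold Cyc at *; grind

theorem Cyc.ne_left {a b c : α} (h : Cyc a b c) : a ≠ b := by
  unfold Cyc at *; grind

theorem Cyc.ne_right {a b c : α} (h : Cyc a b c) : b ≠ c := by
  unfold Cyc at *; grind

theorem Cyc.ne_outer {a b c : α} (h : Cyc a b c) : a ≠ c := by
  unfold Cyc at *; grind

theorem not_cyc_right (a b : α) : ¬ Cyc a b b := fun h => h.ne_right rfl

theorem Cyc.trans {a b c d : α} (h : Cyc a b c) (h' : Cyc a c d) : Cyc a b d := by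
  unfold Cyc at *; grind

theorem Cyc.trans_left {a b c d : α} (h : Cyc a b c) (h' : Cyc a c d) : Cyc b c d := by
  unfold Cyc at *; grind

theorem Cyc.trans_right {a b c d : α} (h : Cyc a b c) (h' : Cyc a c d) : Cyc c d b := by
  unfold Cyc at *; grind

theorem cyc_or {a b c : α} (hab : a ≠ b) (hac : a ≠ c) (hbc : b ≠ c) : Cyc a b c ∨ Cyc a c b := by
  unfold Cyc; grind

theorem cyc_succ {x y p : α} (h : x ⋖ y) (hx : p ≠ x) (hy : p ≠ y) : Cyc x y p := by
  have := h.lt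
  have h2 : ¬ (x < p ∧ p < y) := fun h' => h.2 h'.1 h'.2
  unfold Cyc; grind

/-- No two edges of the graph cross, and any two points whose chord is crossed by no edge are
joined. -/
structure IsMaximalNoncrossing (G : SimpleGraph α) : Prop where
  noncrossing : ∀ a b c d, G.Adj a b → G.Adj c d → a < c → c < b → b < d → False
  maximal : ∀ p q, p < q →
    (∀ c d, G.Adj c d → p < c → c < q → (d < p ∨ q < d) → False) → G.Adj p q

namespace IsMaximalNoncrossing

variable {G : SimpleGraph α} (hG : IsMaximalNoncrossing G)
include hG

theorem not_cross {a b c d : α} (hab : G.Adj a b) (hcd : G.Adj c d) (h : Cyc a c b)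
    (h' : Cyc b d a) : False := by
  have h1 := hG.noncrossing a b c d hab hcd
  have h2 := hG.noncrossing a b d c hab hcd.symm
  have h3 := hG.noncrossing b a c d hab.symm hcd
  have h4 := hG.noncrossing b a d c hab.symm hcd.symm
  have h5 := hG.noncrossing c d a b hcd hab
  have h6 := hG.noncrossing d c a b hcd.symm hab
  have h7 := hG.noncrossing c d b a hcd hab.symm
  have h8 := hG.noncrossing d c b a hcd.symm hab.symm
  unfold Cyc at *
  grind

theorem adj_of_not_cross {p q : α} (hpq : p ≠ q)
    (h : ∀ c d, G.Adj c d → Cyc p c q → Cyc q d p → False) : G.Adj p q := by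
  rcases lt_or_gt_of_ne hpq with hlt | hlt
  · refine hG.maximal p q hlt fun c d hcd h1 h2 h3 => h c d hcd ?_ ?_ <;>
      (unfold Cyc; grind)
  · refine (hG.maximal q p hlt fun c d hcd h1 h2 h3 => h d c hcd.symm ?_ ?_).symm <;>
      (unfold Cyc; grind)

/-- Neighbours of `x` that are consecutive around `x` are joined. -/
theorem adj_of_consecutive {x p q : α} (hp : G.Adj x p) (hq : G.Adj x q) (h : Cyc x p q)
    (hc : ∀ r, G.Adj x r → Cyc x p r → Cyc x r q → False) : G.Adj p q := by
  refine hG.adj_of_not_cross h.ne_right fun c d hcd h1 h2 => ?_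
  -- An edge `c d` crossing `p q` has `c` between the two neighbours. Ending at `x` it contradicts
  -- consecutiveness; otherwise it crosses `x p` or `x q`.
  have hxc : Cyc x p c ∧ Cyc x c q := by unfold Cyc at *; grind
  by_cases hdx : d = x
  · subst hdx
    exact hc c hcd.symm hxc.1 hxc.2
  · by_cases hd : Cyc x d p
    · refine hG.not_cross hp hcd.symm hd ?_
      exact hxc.1.rotate
    · refine hG.not_cross hq hcd hxc.2 ?_
      have hdp : d ≠ p := h2.ne_right
      have h3 := cyc_or (Ne.symm hdx) hp.ne hdp
      unfold Cyc at *; grind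

/-- An edge has at most one triangle on each side: the spoke from `x` to the nearer of two
candidates would cross the edge from `p` to the farther one. -/
theorem eq_of_adj_right {x p q q' : α} (hq : G.Adj x q) (hq' : G.Adj x q')
    (h : Cyc x p q) (h' : Cyc x p q') (hpq : G.Adj p q) (hpq' : G.Adj p q') : q = q' := by
  by_contra hne
  rcases cyc_or hq.ne hq'.ne hne with h1 | h1
  · exact hG.not_cross hq hpq' h h1.rotate
  · exact hG.not_cross hq' hpq h' h1.rotate

theorem eq_of_adj_left {x p p' q : α} (hp : G.Adj x p) (hp' : G.Adj x p')
    (h : Cyc x p q) (h' : Cyc x p' q) (hpq : G.Adj p q) (hpq' : G.Adj p' q) : p = p' := by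
  by_contra hne
  rcases cyc_or hp.ne hp'.ne hne with h1 | h1
  · exact hG.not_cross hp' hpq h1 h'.rotate
  · exact hG.not_cross hp hpq' h1 h.rotate

/-- An edge around the vertex `R` of a triangle goes around the edge opposite to `R`. -/
theorem nested {A P Q R X Z : α} (hPR : G.Adj P R) (hRQ : G.Adj R Q) (hXZ : G.Adj X Z)
    (h1 : Cyc A P R) (h2 : Cyc A R Q) (h3 : Cyc A X R) (h4 : Cyc A R Z) :
    (X = P ∨ Cyc A X P) ∧ (Z = Q ∨ Cyc A Q Z) := by
  constructor
  · by_contra! h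
    have := (cyc_or h3.ne_left h1.ne_left h.1).resolve_left h.2
    exact hG.not_cross hPR hXZ (this.trans_left h3) (h1.trans_right h4)
  · by_contra! h
    have := (cyc_or h4.ne_outer h2.ne_outer h.1).resolve_right h.2
    refine hG.not_cross hRQ hXZ.symm (h4.trans_left this) ?_
    unfold Cyc at *; grind

/-- Finite degree provides a first neighbour after `p`, found by minimising the number of neighbours
in between; `z` only shows that there is a candidate. -/
theorem exists_next {x p z : α} (hfin : (G.neighborSet x).Finite) (hp : G.Adj x p)
    (hz : G.Adj x z) (hpz : Cyc x p z) : ∃ q, G.Adj x q ∧ Cyc x p q ∧ G.Adj p q := by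
  classical
  let S := hfin.toFinset.filter (fun q => Cyc x p q)
  have memS : ∀ q, q ∈ S ↔ G.Adj x q ∧ Cyc x p q := by simp [S]
  obtain ⟨q, hqS, hq⟩ := Finset.exists_min_image S
    (fun q => (S.filter (fun r => Cyc x r q)).card) ⟨z, (memS z).2 ⟨hz, hpz⟩⟩
  obtain ⟨hq1, hq2⟩ := (memS q).1 hqS
  refine ⟨q, hq1, hq2, hG.adj_of_consecutive hp hq1 hq2 fun r hr h1 h2 => ?_⟩
  have hrS := (memS r).2 ⟨hr, h1⟩
  refine absurd (hq r hrS) (not_le.2 (Finset.card_lt_card ?_))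
  rw [Finset.ssubset_iff_of_subset]
  · exact ⟨r, by simp [hrS, h2], by simp [not_cyc_right]⟩
  · intro w hw
    rw [Finset.mem_filter] at hw ⊢
    exact ⟨hw.1, hw.2.trans h2⟩

theorem exists_prev {x q z : α} (hfin : (G.neighborSet x).Finite) (hq : G.Adj x q)
    (hz : G.Adj x z) (hzq : Cyc x z q) : ∃ p, G.Adj x p ∧ Cyc x p q ∧ G.Adj p q := by
  classical
  let S := hfin.toFinset.filter (fun p => Cyc x p q)
  have memS : ∀ p, p ∈ S ↔ G.Adj x p ∧ Cyc x p q := by simp [S]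
  obtain ⟨p, hpS, hp⟩ := Finset.exists_min_image S
    (fun p => (S.filter (fun r => Cyc x p r)).card) ⟨z, (memS z).2 ⟨hz, hzq⟩⟩
  obtain ⟨hp1, hp2⟩ := (memS p).1 hpS
  refine ⟨p, hp1, hp2, hG.adj_of_consecutive hp1 hq hp2 fun r hr h1 h2 => ?_⟩
  have hrS := (memS r).2 ⟨hr, h2⟩
  refine absurd (hp r hrS) (not_le.2 (Finset.card_lt_card ?_))
  rw [Finset.ssubset_iff_of_subset]
  · exact ⟨r, by simp [hrS, h1], by simp [not_cyc_right]⟩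
  · intro w hw
    rw [Finset.mem_filter] at hw ⊢
    exact ⟨hw.1, h1.trans hw.2⟩

end IsMaximalNoncrossing

/-! ### The fan of triangles at a vertex of finite degree -/

open Classical in
/-- The pairs `(p, q)` such that `x`, `p`, `q` are the vertices of a triangle, in cyclic order. -/
noncomputable def fan (G : SimpleGraph α) {x : α} (hfin : (G.neighborSet x).Finite) :
    Finset (α × α) :=
  (hfin.toFinset ×ˢ hfin.toFinset).filter (fun pq => Cyc x pq.1 pq.2 ∧ G.Adj pq.1 pq.2)

theorem mem_fan {G : SimpleGraph α} {x : α} (hfin : (G.neighborSet x).Finite) {pq : α × α} :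
    pq ∈ fan G hfin ↔
      G.Adj x pq.1 ∧ G.Adj x pq.2 ∧ Cyc x pq.1 pq.2 ∧ G.Adj pq.1 pq.2 := by
  simp [fan, and_assoc]

/-- Telescoping along the fan at `x`. -/
theorem IsMaximalNoncrossing.sum_fan {G : SimpleGraph α} (hG : IsMaximalNoncrossing G)
    {x y z : α} (hfin : (G.neighborSet x).Finite) (hy : y ⋖ x) (hz : x ⋖ z) (hxy : G.Adj x y)
    (hxz : G.Adj x z) (h : α → ℤ) :
    ∑ pq ∈ fan G hfin, (h pq.1 - h pq.2) = h z - h y := by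
  classical
  -- In the order around `x`, `z` comes first and `y` last. So first entries of the fan run once
  -- through all neighbours but `y`, second entries through all but `z`.
  have h1 : ∑ pq ∈ fan G hfin, h pq.1 = ∑ p ∈ hfin.toFinset.erase y, h p := by
    refine Finset.sum_bij (fun pq _ => pq.1) ?_ ?_ ?_ (fun _ _ => rfl)
    · rintro ⟨p, q⟩ hpq
      obtain ⟨hp, hq, hc, ha⟩ := (mem_fan hfin).1 hpq
      simp only [Finset.mem_erase, Set.Finite.mem_toFinset, SimpleGraph.mem_neighborSet]
      refine ⟨?_, hp⟩
      rintro rfl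
      exact hc.asymm (cyc_succ hy hc.ne_right.symm hq.ne').rotate
    · rintro ⟨p, q⟩ hpq ⟨p', q'⟩ hpq' (rfl : p = p')
      obtain ⟨hp, hq, hc, ha⟩ := (mem_fan hfin).1 hpq
      obtain ⟨hp', hq', hc', ha'⟩ := (mem_fan hfin).1 hpq'
      exact Prod.ext rfl (hG.eq_of_adj_right hq hq' hc hc' ha ha')
    · intro p hp
      simp only [Finset.mem_erase, Set.Finite.mem_toFinset, SimpleGraph.mem_neighborSet] at hp
      obtain ⟨q, hq, hc, ha⟩ := hG.exists_next hfin hp.2 hxy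
        (cyc_succ hy hp.1 hp.2.ne').rotate
      exact ⟨(p, q), (mem_fan hfin).2 ⟨hp.2, hq, hc, ha⟩, rfl⟩
  have h2 : ∑ pq ∈ fan G hfin, h pq.2 = ∑ p ∈ hfin.toFinset.erase z, h p := by
    refine Finset.sum_bij (fun pq _ => pq.2) ?_ ?_ ?_ (fun _ _ => rfl)
    · rintro ⟨p, q⟩ hpq
      obtain ⟨hp, hq, hc, ha⟩ := (mem_fan hfin).1 hpq
      simp only [Finset.mem_erase, Set.Finite.mem_toFinset, SimpleGraph.mem_neighborSet]
      refine ⟨?_, hq⟩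
      rintro rfl
      exact hc.asymm (cyc_succ hz hp.ne' hc.ne_right)
    · rintro ⟨p, q⟩ hpq ⟨p', q'⟩ hpq' (rfl : q = q')
      obtain ⟨hp, hq, hc, ha⟩ := (mem_fan hfin).1 hpq
      obtain ⟨hp', hq', hc', ha'⟩ := (mem_fan hfin).1 hpq'
      exact Prod.ext (hG.eq_of_adj_left hp hp' hc hc' ha ha') rfl
    · intro q hq
      simp only [Finset.mem_erase, Set.Finite.mem_toFinset, SimpleGraph.mem_neighborSet] at hq
      obtain ⟨p, hp, hc, ha⟩ := hG.exists_prev hfin hq.2 hxz (cyc_succ hz hq.2.ne' hq.1)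
      exact ⟨(p, q), (mem_fan hfin).2 ⟨hp, hq.2, hc, ha⟩, rfl⟩
  rw [Finset.sum_sub_distrib, h1, h2]
  have e1 := Finset.add_sum_erase hfin.toFinset h (a := y) (by simpa using hxy)
  have e2 := Finset.add_sum_erase hfin.toFinset h (a := z) (by simpa using hxz)
  linarith

/-- The triangles of a graph at the vertex `x`. -/
def cliquesAt (G : SimpleGraph α) (x : α) : Set (Finset α) := {Δ ∈ G.cliqueSet 3 | x ∈ Δ}

theorem cliquesAt_eq_image_fan {G : SimpleGraph α} {x : α} (hfin : (G.neighborSet x).Finite) :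
    cliquesAt G x = (fun pq : α × α => ({x, pq.1, pq.2} : Finset α)) '' (fan G hfin) := by
  ext Δ
  constructor
  · rintro ⟨hΔ, hx⟩
    obtain ⟨a, b, c, hab, hac, hbc, rfl⟩ := SimpleGraph.is3Clique_iff.1 hΔ
    have key : ∀ p q, G.Adj x p → G.Adj x q → G.Adj p q →
        ∃ pq ∈ fan G hfin, ({x, pq.1, pq.2} : Finset α) = {x, p, q} := by
      intro p q hp hq hpq
      rcases cyc_or hp.ne hq.ne hpq.ne with h | h
      · exact ⟨(p, q), (mem_fan hfin).2 ⟨hp, hq, h, hpq⟩, rfl⟩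
      · exact ⟨(q, p), (mem_fan hfin).2 ⟨hq, hp, h, hpq.symm⟩, by
          ext; simp; tauto⟩
    simp only [Finset.mem_insert, Finset.mem_singleton] at hx
    rcases hx with rfl | rfl | rfl
    · exact key b c hab hac hbc
    · obtain ⟨pq, h1, h2⟩ := key a c hab.symm hbc hac
      exact ⟨pq, h1, h2.trans (by ext; simp; tauto)⟩
    · obtain ⟨pq, h1, h2⟩ := key a b hac.symm hbc.symm hab
      exact ⟨pq, h1, h2.trans (by ext; simp; tauto)⟩
  · rintro ⟨pq, hpq, rfl⟩
    obtain ⟨hp, hq, hc, ha⟩ := (mem_fan hfin).1 hpq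
    exact ⟨SimpleGraph.is3Clique_iff.2 ⟨x, pq.1, pq.2, hp, hq, ha, rfl⟩, by simp⟩

theorem injOn_fan {G : SimpleGraph α} {x : α} (hfin : (G.neighborSet x).Finite) :
    Set.InjOn (fun pq : α × α => ({x, pq.1, pq.2} : Finset α)) (fan G hfin) := by
  rintro ⟨p, q⟩ h ⟨p', q'⟩ h' heq
  obtain ⟨hp, hq, hc, ha⟩ := (mem_fan hfin).1 h
  obtain ⟨hp', hq', hc', ha'⟩ := (mem_fan hfin).1 h'
  have h1 : ∀ y, y = x ∨ y = p ∨ y = q ↔ y = x ∨ y = p' ∨ y = q' := by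
    intro y
    have := Finset.ext_iff.1 heq y
    simpa using this
  have hpp := h1 p
  have hqq := h1 q
  have := hp.ne'; have := hq.ne'; have := ha.ne
  have hs : ¬ (p = q' ∧ q = p') := by
    rintro ⟨rfl, rfl⟩
    exact hc.asymm hc'
  simp only [Prod.mk.injEq]
  grind

theorem finite_cliquesAt {G : SimpleGraph α} {x : α} (hfin : (G.neighborSet x).Finite) :
    (cliquesAt G x).Finite := by
  rw [cliquesAt_eq_image_fan hfin]
  exact (Finset.finite_toSet _).image _

theorem ncard_cliquesAt {G : SimpleGraph α} {x : α} (hfin : (G.neighborSet x).Finite) :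
    (cliquesAt G x).ncard = (fan G hfin).card := by
  rw [cliquesAt_eq_image_fan hfin, (injOn_fan hfin).ncard_image, Set.ncard_coe_finset]

theorem sum_cliquesAt {G : SimpleGraph α} {x : α} (hfin : (G.neighborSet x).Finite)
    (f : Finset α → ℤ) : ∑ Δ ∈ (finite_cliquesAt hfin).toFinset, f Δ =
      ∑ pq ∈ fan G hfin, f {x, pq.1, pq.2} := by
  classical
  rw [← Finset.sum_image (f := f) (injOn_fan hfin)]
  congr 1
  ext Δ
  rw [Set.Finite.mem_toFinset, cliquesAt_eq_image_fan hfin]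
  simp

end Cyclic

end Strip

/-! ### Conway–Coxeter labels -/

namespace Strip

variable {M₂ : Set ℤ}

section Labelling

variable {T : Set (Arc M₂)} {A : MarkedPoint M₂}

theorem mem_triangles_iff {P Q R : MarkedPoint M₂} : {P, Q, R} ∈ triangles T ↔
    (edgeGraph T).Adj P Q ∧ (edgeGraph T).Adj P R ∧ (edgeGraph T).Adj Q R :=
  SimpleGraph.is3Clique_triple_iff

/-- The labelling `L` is an intermediate stage of the procedure started at `A`. -/
def Reaches (T : Set (Arc M₂)) (A : MarkedPoint M₂) (L : MarkedPoint M₂ → Option ℕ) : Prop :=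
  Relation.ReflTransGen (CCStep T) (ccInit T A) L

/-- The properties of a labelling that the procedure started at `A` preserves. -/
structure IsLabelling (T : Set (Arc M₂)) (A : MarkedPoint M₂) (L : MarkedPoint M₂ → Option ℕ) :
    Prop where
  base : L A = some 0
  adj : ∀ P, (edgeGraph T).Adj A P → L P = some 1
  pos : ∀ P p, P ≠ A → L P = some p → 1 ≤ p
  -- Seen from `A`, a label behind the edge `P Q` must have been carried across it.
  separating : ∀ P R Q, (edgeGraph T).Adj P Q → Cyc A P R → Cyc A R Q → L R ≠ none →
    L P ≠ none ∧ L Q ≠ none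
  sum : ∀ P R Q r, (edgeGraph T).Adj P Q → (edgeGraph T).Adj P R → (edgeGraph T).Adj R Q →
    Cyc A P R → Cyc A R Q → L R = some r → ∃ p q, L P = some p ∧ L Q = some q ∧ r = p + q

/-- A point behind an edge cannot be joined to `A` without a crossing, so it starts unlabelled and
the last two properties are vacuous. -/
theorem isLabelling_ccInit (hG : IsMaximalNoncrossing (edgeGraph T)) :
    IsLabelling T A (ccInit T A) := by
  classical
  have key : ∀ P R Q, (edgeGraph T).Adj P Q → Cyc A P R → Cyc A R Q → ccInit T A R = none := by
    intro P R Q hPQ h1 h2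
    have hn : ¬ (edgeGraph T).Adj A R := fun h =>
      hG.not_cross hPQ h.symm (h1.trans_left h2) (h1.trans h2).rotate.rotate
    simp [ccInit, h1.ne_outer.symm, hn]
  refine ⟨by simp [ccInit], fun P h => by simp [ccInit, h, h.ne'], fun P p hP h => ?_,
    fun P R Q hPQ h1 h2 h => absurd (key P R Q hPQ h1 h2) h,
    fun P R Q r hPQ _ _ h1 h2 h => ?_⟩
  · simp only [ccInit, hP, if_false] at h
    split_ifs at h
    simp at h; omega
  · rw [key P R Q hPQ h1 h2] at h
    cases h

/-- In a triangle with exactly two labelled vertices, the third vertex lies behind the edge joining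
the other two. -/
theorem IsLabelling.cyc_of_triangle {L : MarkedPoint M₂ → Option ℕ} (hL : IsLabelling T A L)
    {P Q R : MarkedPoint M₂} (hPQ : (edgeGraph T).Adj P Q) (hPR : (edgeGraph T).Adj P R)
    (hQR : (edgeGraph T).Adj Q R) (hP : L P ≠ none) (hQ : L Q ≠ none) (hR : L R = none) :
    (Cyc A P R ∧ Cyc A R Q) ∨ (Cyc A Q R ∧ Cyc A R P) := by
  have hRA : R ≠ A := by rintro rfl; simp [hL.base] at hR
  have hPA : P ≠ A := by rintro rfl; simp [hL.adj R hPR] at hR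
  have hQA : Q ≠ A := by rintro rfl; simp [hL.adj R hQR] at hR
  -- `A` is none of the three vertices, since its neighbours are all labelled. A labelled `P` or `Q`
  -- behind an edge ending at `R` would force a label on `R`.
  have s1 := fun h1 h2 => (hL.separating P Q R hPR h1 h2 hQ).2 hR
  have s2 := fun h1 h2 => (hL.separating R Q P hPR.symm h1 h2 hQ).1 hR
  have s3 := fun h1 h2 => (hL.separating Q P R hQR h1 h2 hP).2 hR
  have s4 := fun h1 h2 => (hL.separating R P Q hQR.symm h1 h2 hP).1 hR
  have := cyc_or hPA.symm hRA.symm hPR.ne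
  have := cyc_or hPA.symm hQA.symm hPQ.ne
  have := cyc_or hQA.symm hRA.symm hQR.ne
  tauto

/-- Only the new label at `R` needs checking. An edge around `R` goes around `P Q`, so its ends were
labelled before; if it forms a triangle with `R`, nesting in both directions makes that triangle `P,
R, Q`. -/
theorem IsLabelling.update {L : MarkedPoint M₂ → Option ℕ}
    (hG : IsMaximalNoncrossing (edgeGraph T)) (hL : IsLabelling T A L)
    {P Q R : MarkedPoint M₂} {p q : ℕ} (hPQ : (edgeGraph T).Adj P Q)
    (hPR : (edgeGraph T).Adj P R) (hRQ : (edgeGraph T).Adj R Q) (hP : L P = some p)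
    (hQ : L Q = some q) (hR : L R = none) (h1 : Cyc A P R) (h2 : Cyc A R Q) :
    IsLabelling T A (Function.update L R (some (p + q))) := by
  have hRA : R ≠ A := h1.ne_outer.symm
  have hPA : P ≠ A := h1.ne_left.symm
  have mono : ∀ X, L X ≠ none → Function.update L R (some (p + q)) X = L X := by
    intro X hX
    rw [Function.update_of_ne]
    rintro rfl
    exact hX hR
  have mono' : ∀ X, L X ≠ none → Function.update L R (some (p + q)) X ≠ none := by
    intro X hX
    rwa [mono X hX]
  refine ⟨?_, fun X hX => ?_, fun X x hXA hX => ?_, fun X Y Z hXZ hXY hYZ hY => ?_,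
    fun X Y Z y hXZ hXYa hYZa hXY hYZ hY => ?_⟩
  · rw [mono _ (by simp [hL.base]), hL.base]
  · rw [mono _ (by simp [hL.adj X hX]), hL.adj X hX]
  · by_cases hXR : X = R
    · subst hXR
      simp only [Function.update_self, Option.some.injEq] at hX
      have := hL.pos P p hPA hP
      omega
    · rw [Function.update_of_ne hXR] at hX
      exact hL.pos X x hXA hX
  · by_cases hYR : Y = R
    · subst hYR
      obtain ⟨hX, hZ⟩ := hG.nested hPR hRQ hXZ h1 h2 hXY hYZ
      rcases hX with rfl | hX
      · rcases hZ with rfl | hZ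
        · exact ⟨mono' _ (by simp [hP]), mono' _ (by simp [hQ])⟩
        · have := hL.separating X Q Z hXZ (h1.trans h2) hZ (by simp [hQ])
          exact ⟨mono' _ this.1, mono' _ this.2⟩
      · have := hL.separating X P Z hXZ hX (h1.trans hYZ) (by simp [hP])
        exact ⟨mono' _ this.1, mono' _ this.2⟩
    · rw [Function.update_of_ne hYR] at hY
      obtain ⟨hX, hZ⟩ := hL.separating X Y Z hXZ hXY hYZ hY
      exact ⟨mono' X hX, mono' Z hZ⟩
  · by_cases hYR : Y = R
    · subst hYR
      obtain ⟨hX, hZ⟩ := hG.nested hPR hRQ hXZ h1 h2 hXY hYZ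
      obtain ⟨hX', hZ'⟩ := hG.nested hXYa hYZa hPQ hXY hYZ h1 h2
      have eX : X = P := hX.elim id fun h => hX'.elim Eq.symm fun h' =>
        absurd h' h.asymm
      have eZ : Z = Q := hZ.elim id fun h => hZ'.elim Eq.symm fun h' => absurd h' h.asymm
      subst eX eZ
      rw [Function.update_self, Option.some.injEq] at hY
      exact ⟨p, q, by rw [mono _ (by simp [hP]), hP], by rw [mono _ (by simp [hQ]), hQ], hY.symm⟩
    · rw [Function.update_of_ne hYR] at hY
      obtain ⟨x, z, hx, hz, hxz⟩ := hL.sum X Y Z y hXZ hXYa hYZa hXY hYZ hY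
      exact ⟨x, z, by rw [mono X (by simp [hx]), hx], by rw [mono Z (by simp [hz]), hz], hxz⟩

theorem Reaches.isLabelling (hG : IsMaximalNoncrossing (edgeGraph T))
    {L : MarkedPoint M₂ → Option ℕ} (hL : Reaches T A L) : IsLabelling T A L := by
  induction hL with
  | refl => exact isLabelling_ccInit hG
  | tail _ hstep ih =>
    obtain ⟨P, Q, R, p, q, hΔ, hP, hQ, hR, rfl⟩ := hstep
    obtain ⟨hPQ, hPR, hQR⟩ := mem_triangles_iff.1 hΔ
    rcases ih.cyc_of_triangle hPQ hPR hQR (by simp [hP]) (by simp [hQ]) hR with h | h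
    · exact ih.update hG hPQ hPR hQR.symm hP hQ hR h.1 h.2
    · rw [add_comm]
      exact ih.update hG hPQ.symm hQR hPR.symm hQ hP hR h.1 h.2

/-- Any two runs of the labelling procedure agree. -/
theorem Reaches.eq_of_eq_some (hG : IsMaximalNoncrossing (edgeGraph T))
    {L L' : MarkedPoint M₂ → Option ℕ} (hL : Reaches T A L) (hL' : Reaches T A L') :
    ∀ {B : MarkedPoint M₂} {x y : ℕ}, L B = some x → L' B = some y → x = y := by
  classical
  have hI' := hL'.isLabelling hG
  induction hL with
  | refl =>
    intro B x y hx hy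
    simp only [ccInit] at hx
    split_ifs at hx with h1 h2
    · subst h1
      have := hI'.base
      simp_all
    · have := hI'.adj B h2
      simp_all
  | @tail L₁ L₂ hL₁ hstep ih =>
    obtain ⟨P, Q, R, p, q, hΔ, hP, hQ, hR, rfl⟩ := hstep
    intro B x y hx hy
    by_cases hBR : B = R
    · subst hBR
      rw [Function.update_self, Option.some.injEq] at hx
      obtain ⟨hPQ, hPR, hQR⟩ := mem_triangles_iff.1 hΔ
      have hI := Reaches.isLabelling hG hL₁
      -- Whichever step labelled this vertex in the other run, the `sum` invariant splits its label
      -- across the same triangle.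
      rcases hI.cyc_of_triangle hPQ hPR hQR (by simp [hP]) (by simp [hQ]) hR with h | h
      · obtain ⟨p', q', hp, hq, rfl⟩ := hI'.sum P B Q y hPQ hPR hQR.symm h.1 h.2 hy
        rw [← hx, ih hP hp, ih hQ hq]
      · obtain ⟨q', p', hq, hp, rfl⟩ := hI'.sum Q B P y hPQ.symm hQR hPR.symm h.1 h.2 hy
        rw [← hx, ih hP hp, ih hQ hq, add_comm]
    · rw [Function.update_of_ne hBR] at hx
      exact ih hx hy

/-- Two runs of the labelling procedure can be continued to a common one. -/
theorem Reaches.exists_union (hG : IsMaximalNoncrossing (edgeGraph T))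
    {L L' : MarkedPoint M₂ → Option ℕ} (hL : Reaches T A L) (hL' : Reaches T A L') :
    ∃ K, Reaches T A K ∧ ∀ B, L B ≠ none ∨ L' B ≠ none → K B ≠ none := by
  induction hL' with
  | refl =>
    refine ⟨L, hL, fun B hB => hB.elim id fun hB => ?_⟩
    obtain ⟨x, hx⟩ := Option.ne_none_iff_exists'.1 hB
    have hI := hL.isLabelling hG
    simp only [ccInit] at hx
    split_ifs at hx with h1 h2
    · simp [h1, hI.base]
    · simp [hI.adj B h2]
  | tail _ hstep ih =>
    obtain ⟨K, hK, hdom⟩ := ih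
    obtain ⟨P, Q, R, p, q, hΔ, hP, hQ, hR, rfl⟩ := hstep
    -- Replay the step of the second run on `K`, unless its vertex is already labelled there.
    by_cases hKR : K R = none
    · obtain ⟨p', hp'⟩ := Option.ne_none_iff_exists'.1 (hdom P (by simp [hP]))
      obtain ⟨q', hq'⟩ := Option.ne_none_iff_exists'.1 (hdom Q (by simp [hQ]))
      refine ⟨_, hK.tail ⟨P, Q, R, p', q', hΔ, hp', hq', hKR, rfl⟩, fun B hB => ?_⟩
      by_cases hBR : B = R
      · simp [hBR]
      · rw [Function.update_of_ne hBR] at hB ⊢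
        exact hdom B hB
    · refine ⟨K, hK, fun B hB => ?_⟩
      by_cases hBR : B = R
      · rwa [hBR]
      · rw [Function.update_of_ne hBR] at hB
        exact hdom B hB

/-- The procedure started at `A` eventually labels `B`. -/
def IsLabelled (T : Set (Arc M₂)) (A B : MarkedPoint M₂) : Prop := ∃ x, CCLabel T A B x

theorem CCLabel.unique (hG : IsMaximalNoncrossing (edgeGraph T)) {B : MarkedPoint M₂} {x y : ℕ}
    (hx : CCLabel T A B x) (hy : CCLabel T A B y) : x = y := by
  obtain ⟨L, hL, hLx⟩ := hx
  obtain ⟨L', hL', hLy⟩ := hy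
  exact Reaches.eq_of_eq_some hG hL hL' hLx hLy

theorem ccLabel_self : CCLabel T A A 0 :=
  ⟨_, .refl, by simp [ccInit]⟩

theorem ccLabel_of_adj {B : MarkedPoint M₂} (h : (edgeGraph T).Adj A B) : CCLabel T A B 1 :=
  ⟨_, .refl, by simp [ccInit, h, h.ne']⟩

theorem CCLabel.pos (hG : IsMaximalNoncrossing (edgeGraph T)) {B : MarkedPoint M₂} {x : ℕ}
    (hBA : B ≠ A) (hx : CCLabel T A B x) : 1 ≤ x := by
  obtain ⟨L, hL, hLx⟩ := hx
  exact (Reaches.isLabelling hG hL).pos B x hBA hLx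

theorem IsLabelled.of_triangle (hG : IsMaximalNoncrossing (edgeGraph T)) {P Q R : MarkedPoint M₂}
    (hP : IsLabelled T A P) (hQ : IsLabelled T A Q) (hPQ : (edgeGraph T).Adj P Q)
    (hPR : (edgeGraph T).Adj P R) (hQR : (edgeGraph T).Adj Q R) : IsLabelled T A R := by
  obtain ⟨p, L, hL, hp⟩ := hP
  obtain ⟨q, L', hL', hq⟩ := hQ
  obtain ⟨K, hK, hdom⟩ := Reaches.exists_union hG hL hL'
  obtain ⟨p', hp'⟩ := Option.ne_none_iff_exists'.1 (hdom P (by simp [hp]))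
  obtain ⟨q', hq'⟩ := Option.ne_none_iff_exists'.1 (hdom Q (by simp [hq]))
  by_cases hR : K R = none
  · exact ⟨p' + q', _, hK.tail ⟨P, Q, R, p', q', mem_triangles_iff.2 ⟨hPQ, hPR, hQR⟩, hp', hq',
      hR, rfl⟩, by simp⟩
  · obtain ⟨r, hr⟩ := Option.ne_none_iff_exists'.1 hR
    exact ⟨r, K, hK, hr⟩

open Classical in
/-- The label of `B` in the procedure started at `A` (zero if there is none). -/
noncomputable def label (T : Set (Arc M₂)) (A B : MarkedPoint M₂) : ℕ :=
  if h : IsLabelled T A B then h.choose else 0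

theorem IsLabelled.ccLabel {B : MarkedPoint M₂} (h : IsLabelled T A B) :
    CCLabel T A B (label T A B) := by
  rw [label, dif_pos h]
  exact h.choose_spec

theorem CCLabel.label_eq (hG : IsMaximalNoncrossing (edgeGraph T)) {B : MarkedPoint M₂} {x : ℕ}
    (hx : CCLabel T A B x) : label T A B = x :=
  CCLabel.unique hG (IsLabelled.ccLabel ⟨x, hx⟩) hx

theorem label_add (hG : IsMaximalNoncrossing (edgeGraph T)) {P R Q : MarkedPoint M₂}
    (hPQ : (edgeGraph T).Adj P Q) (hPR : (edgeGraph T).Adj P R) (hRQ : (edgeGraph T).Adj R Q)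
    (h1 : Cyc A P R) (h2 : Cyc A R Q) (hR : IsLabelled T A R) :
    label T A R = label T A P + label T A Q := by
  obtain ⟨r, L, hL, hr⟩ := hR
  obtain ⟨p, q, hp, hq, rfl⟩ :=
    (Reaches.isLabelling hG hL).sum P R Q r hPQ hPR hRQ h1 h2 hr
  rw [CCLabel.label_eq hG ⟨L, hL, hr⟩, CCLabel.label_eq hG ⟨L, hL, hp⟩,
    CCLabel.label_eq hG ⟨L, hL, hq⟩]

/-- All neighbours of a labelled vertex of finite degree with a labelled lower boundary neighbour
are labelled. -/
theorem IsLabelled.of_adj (hG : IsMaximalNoncrossing (edgeGraph T)) {x y p : MarkedPoint M₂}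
    (hfin : ((edgeGraph T).neighborSet x).Finite) (hyx : y ⋖ x) (hx : IsLabelled T A x)
    (hy : IsLabelled T A y) (hp : (edgeGraph T).Adj x p) : IsLabelled T A p := by
  classical
  have hxy : (edgeGraph T).Adj x y := Or.inr (Or.inr hyx)
  -- Labels spread backwards from `y`, the last neighbour around `x`; the induction counts the
  -- neighbours after `p`.
  induction hn : (hfin.toFinset.filter (fun r => Cyc x p r)).card using Nat.strong_induction_on
    generalizing p with
  | _ n ih =>
    by_cases hpy : p = y
    · rwa [hpy]
    obtain ⟨q, hq, hc, ha⟩ := hG.exists_next hfin hp hxy (cyc_succ hyx hpy hp.ne').rotate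
    refine IsLabelled.of_triangle hG hx (ih _ ?_ hq rfl) hq hp ha.symm
    rw [← hn]
    refine Finset.card_lt_card ?_
    rw [Finset.ssubset_iff_of_subset]
    · exact ⟨q, by simp [hq, hc], by simp [not_cyc_right]⟩
    · intro w hw
      rw [Finset.mem_filter] at hw ⊢
      exact ⟨hw.1, hc.trans hw.2⟩

/-- The labels around a vertex of finite degree. -/
theorem label_add_label (hG : IsMaximalNoncrossing (edgeGraph T)) {x y z : MarkedPoint M₂}
    (hfin : ((edgeGraph T).neighborSet x).Finite) (hyx : y ⋖ x) (hxz : x ⋖ z) (hAx : A < x)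
    (hx : IsLabelled T A x) (hy : IsLabelled T A y) :
    (label T A z : ℤ) + label T A y = (fan (edgeGraph T) hfin).card * label T A x := by
  classical
  have hxy' : (edgeGraph T).Adj x y := Or.inr (Or.inr hyx)
  have hxz' : (edgeGraph T).Adj x z := Or.inr (Or.inl hxz)
  -- Vertices beyond `x`, seen from `A`, count positively and the others negatively; each triangle
  -- `x, p, q` will then contribute exactly the label of `x`.
  have hsum := hG.sum_fan hfin hyx hxz hxy' hxz'
    (fun p => if Cyc A x p then (label T A p : ℤ) else - label T A p)
  have hz : Cyc A x z := Or.inl ⟨hAx, hxz.lt⟩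
  have hAy : A ≤ y := hyx.le_of_lt hAx
  have hy' : ¬ Cyc A x y := by
    have := hyx.lt
    unfold Cyc; grind
  simp only [if_pos hz, if_neg hy', sub_neg_eq_add] at hsum
  rw [← hsum, ← nsmul_eq_mul, ← Finset.sum_const]
  refine Finset.sum_congr rfl ?_
  rintro ⟨p, q⟩ hpq
  obtain ⟨hp, hq, hc, ha⟩ := (mem_fan hfin).1 hpq
  have lp := IsLabelled.of_adj hG hfin hyx hx hy hp
  have lq := IsLabelled.of_adj hG hfin hyx hx hy hq
  simp only at hp hq hc ha lp lq ⊢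
  have h0 : label T A A = 0 := CCLabel.label_eq hG ccLabel_self
  by_cases hpA : p = A
  · subst hpA
    rw [CCLabel.label_eq hG (ccLabel_of_adj hp.symm), CCLabel.label_eq hG (ccLabel_of_adj ha), h0,
      if_neg (by unfold Cyc at *; grind), if_neg (by unfold Cyc at *; grind)]
    simp
  by_cases hqA : q = A
  · subst hqA
    rw [CCLabel.label_eq hG (ccLabel_of_adj hq.symm),
      CCLabel.label_eq hG (ccLabel_of_adj ha.symm), h0,
      if_pos (hc.rotate.rotate)]
    simp
  -- The label of the middle vertex in the order from `A` is the sum of the other two; the middle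
  -- one is `p`, `x` or `q` in the three cases.
  rcases cyc_or hAx.ne (Ne.symm hpA) hp.ne with h1 | h1
  · rw [if_pos h1]
    rcases cyc_or hAx.ne (Ne.symm hqA) hq.ne with h2 | h2
    · rw [if_pos h2]
      have h3 : Cyc A p q := by unfold Cyc at *; grind
      rw [label_add hG hq hp ha h1 h3 lp]
      push_cast; ring
    · rw [if_neg h2.asymm, label_add hG ha.symm hq.symm hp h2 h1 hx]
      push_cast; ring
  · rw [if_neg h1.asymm]
    have h2 : Cyc A q x := by unfold Cyc at *; grind
    rw [if_neg h2.asymm]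
    have h3 : Cyc A p q := by unfold Cyc at *; grind
    rw [label_add hG hp.symm ha hq.symm h3 h2 lq]
    push_cast; ring

end Labelling

end Strip

/-! ### Broline–Crowe–Isaacs tuples -/

namespace Strip

section Tuples

variable {β : Type*}

open Classical in
/-- The number of tuples of distinct elements outside `F`, chosen one after the other from the
sets `S n, S (n - 1), …, S 1`. -/
noncomputable def tupleCount (S : ℕ → Finset β) : ℕ → Set β → ℕ
  | 0, _ => 1
  | n + 1, F => ∑ Δ ∈ (S (n + 1)).filter (· ∉ F), tupleCount S n (insert Δ F)

theorem finite_tuples (S : ℕ → Finset β) (n : ℕ) (F : Set β) :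
    {f : Fin n → β | Function.Injective f ∧ ∀ k : Fin n, f k ∈ S (k + 1) ∧ f k ∉ F}.Finite :=
  (Set.Finite.pi (fun k : Fin n => (S (k + 1)).finite_toSet)).subset
    fun _ hf k _ => (hf.2 k).1

/-- Sort the tuples by their last entry; forbidding that entry to the remaining places encodes
injectivity. -/
theorem ncard_tuples (S : ℕ → Finset β) (n : ℕ) (F : Set β) :
    {f : Fin n → β | Function.Injective f ∧ ∀ k : Fin n, f k ∈ S (k + 1) ∧ f k ∉ F}.ncard =
      tupleCount S n F := by
  classical
  induction n generalizing F with
  | zero =>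
    rw [tupleCount, Set.ncard_eq_one]
    exact ⟨Fin.elim0, by
      ext f
      simp only [Set.mem_ofPred_eq, Set.mem_singleton_iff]
      exact ⟨fun _ => Subsingleton.elim _ _,
        fun _ => ⟨Function.injective_of_subsingleton f, fun k => k.elim0⟩⟩⟩
  | succ n ih =>
    rw [Set.ncard_eq_toFinset_card _ (finite_tuples S (n + 1) F), tupleCount]
    rw [Finset.card_eq_sum_card_fiberwise (f := fun f : Fin (n + 1) → β => f (Fin.last n))
      (t := (S (n + 1)).filter (· ∉ F))]
    · refine Finset.sum_congr rfl fun Δ hΔ => ?_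
      rw [Finset.mem_filter] at hΔ
      rw [← ih, Set.ncard_eq_toFinset_card _ (finite_tuples S n (insert Δ F))]
      refine Finset.card_bij (fun f _ => Fin.init f) ?_ ?_ ?_
      · intro f hf
        simp only [Finset.mem_filter, Set.Finite.mem_toFinset, Set.mem_ofPred_eq] at hf ⊢
        obtain ⟨⟨hinj, hf⟩, rfl⟩ := hf
        refine ⟨fun a b hab => Fin.castSucc_injective n (hinj hab), fun k => ⟨?_, ?_⟩⟩
        · simpa [Fin.init] using (hf k.castSucc).1
        · rintro (h | h)
          · exact (Fin.castSucc_lt_last k).ne (hinj h)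
          · exact (hf k.castSucc).2 h
      · intro f hf g hg hfg
        simp only [Finset.mem_filter] at hf hg
        rw [← Fin.snoc_init_self f, ← Fin.snoc_init_self g, hfg, hf.2, hg.2]
      · intro g hg
        simp only [Set.Finite.mem_toFinset, Set.mem_ofPred_eq, Set.mem_insert_iff, not_or] at hg
        refine ⟨Fin.snoc (α := fun _ => β) g Δ, ?_, Fin.init_snoc _ _⟩
        simp only [Finset.mem_filter, Set.Finite.mem_toFinset, Set.mem_ofPred_eq, Fin.snoc_last,
          and_true]
        refine ⟨Fin.snoc_injective_iff.2 ⟨hg.1, ?_⟩, fun k => ?_⟩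
        · rintro ⟨k, hk⟩
          exact (hg.2 k).2.1 hk
        · refine Fin.lastCases ?_ (fun k => ?_) k
          · simpa using hΔ
          · simpa using ⟨(hg.2 k).1, (hg.2 k).2.2⟩
    · intro f hf
      simp only [Finset.mem_coe, Set.Finite.mem_toFinset, Set.mem_ofPred_eq] at hf
      simpa using hf.2 (Fin.last n)

/-- Only the members of `F` in the sets `S 1, …, S n` matter. -/
theorem tupleCount_congr {S : ℕ → Finset β} {n : ℕ} {F F' : Set β}
    (h : ∀ l, 1 ≤ l → l ≤ n → ∀ Δ ∈ S l, Δ ∈ F ↔ Δ ∈ F') :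
    tupleCount S n F = tupleCount S n F' := by
  classical
  induction n generalizing F F' with
  | zero => rfl
  | succ n ih =>
    rw [tupleCount, tupleCount]
    refine Finset.sum_congr ?_ fun Δ _ => ih fun l h1 h2 Δ' hΔ' => ?_
    · refine Finset.filter_congr fun Δ hΔ => not_congr (h (n + 1) (by omega) le_rfl Δ hΔ)
    · simp [h l h1 (by omega) Δ' hΔ']

/-- `Δ` is available only at the top place. Tuples not using it there are counted by forbidding it;
for those using it, the remaining places are unaffected. -/
theorem tupleCount_insert {S : ℕ → Finset β} {n : ℕ} {F : Set β} {Δ : β} (hΔ : Δ ∈ S (n + 1))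
    (hF : Δ ∉ F) (h : ∀ l, 1 ≤ l → l ≤ n → Δ ∉ S l) :
    tupleCount S (n + 1) F = tupleCount S (n + 1) (insert Δ F) + tupleCount S n F := by
  classical
  have hins : ∀ F' : Set β, tupleCount S n (insert Δ F') = tupleCount S n F' := fun F' =>
    tupleCount_congr fun l h1 h2 Δ' hΔ' => by
      have : Δ' ≠ Δ := by rintro rfl; exact h l h1 h2 hΔ'
      simp [this]
  rw [tupleCount, tupleCount, ← Finset.add_sum_erase _ _ (a := Δ) (by simp [hΔ, hF]), hins,
    add_comm]
  congr 1
  refine Finset.sum_congr ?_ fun Δ' _ => ?_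
  · ext Δ'
    simp only [Finset.mem_erase, Finset.mem_filter, Set.mem_insert_iff, not_or]
    tauto
  · rw [Set.insert_comm, hins]

end Tuples

section Walk

variable {α : Type*} [LinearOrder α] {G : SimpleGraph α} {v : ℕ → α}

/-- The triangles whose vertices all lie between `x` and `y`. -/
def trianglesIn (G : SimpleGraph α) (x y : α) : Set (Finset α) :=
  {Δ ∈ G.cliqueSet 3 | ∀ p ∈ Δ, x ≤ p ∧ p ≤ y}

/-- An edge leaving `z` for a point outside the interval would cross `x y`. -/
theorem mem_trianglesIn_of_between (hG : IsMaximalNoncrossing G) {x y z : α} {Δ : Finset α}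
    (hxy : G.Adj x y) (hx : x < z) (hy : z < y) (hΔ : Δ ∈ cliquesAt G z) :
    Δ ∈ trianglesIn G x y := by
  refine ⟨hΔ.1, fun p hp => ?_⟩
  by_cases hpz : p = z
  · subst hpz; exact ⟨hx.le, hy.le⟩
  have hadj : G.Adj z p := hΔ.1.isClique hΔ.2 hp (Ne.symm hpz)
  by_contra! h
  rcases lt_or_ge p x with h1 | h1
  · exact hG.noncrossing p z x y hadj.symm hxy h1 hx hy
  · exact hG.noncrossing x y z p hxy hadj hx hy (h h1)

/-- The triangles under the edge `x y` of a triangle `x`, `m`, `y`. -/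
theorem trianglesIn_eq (hG : IsMaximalNoncrossing G) {x m y : α} (hxm : x < m) (hmy : m < y)
    (axm : G.Adj x m) (amy : G.Adj m y) (axy : G.Adj x y) :
    trianglesIn G x y = insert {x, m, y} (trianglesIn G x m ∪ trianglesIn G m y) := by
  ext Δ
  constructor
  · rintro ⟨hΔ, hb⟩
    by_cases h1 : ∀ p ∈ Δ, p ≤ m
    · exact Or.inr (Or.inl ⟨hΔ, fun p hp => ⟨(hb p hp).1, h1 p hp⟩⟩)
    by_cases h2 : ∀ p ∈ Δ, m ≤ p
    · exact Or.inr (Or.inr ⟨hΔ, fun p hp => ⟨h2 p hp, (hb p hp).2⟩⟩)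
    push Not at h1 h2
    obtain ⟨q, hq, hmq⟩ := h1
    obtain ⟨p, hp, hpm⟩ := h2
    -- An edge passing over `m` crosses `x m` or `m y` unless it is `x y` itself.
    have key : ∀ p' ∈ Δ, ∀ q' ∈ Δ, p' < m → m < q' → p' = x ∧ q' = y := by
      intro p' hp' q' hq' h1 h2
      have hadj : G.Adj p' q' := hΔ.isClique hp' hq' (h1.trans h2).ne
      refine ⟨(eq_or_lt_of_le (hb p' hp').1).elim Eq.symm fun h => ?_,
        (eq_or_lt_of_le (hb q' hq').2).elim id fun h => ?_⟩
      · exact (hG.noncrossing x m p' q' axm hadj h h1 h2).elim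
      · exact (hG.noncrossing p' q' m y hadj amy h1 h2 h).elim
    left
    obtain ⟨rfl, rfl⟩ := key p hp q hq hpm hmq
    refine Finset.eq_of_subset_of_card_le (fun r hr => ?_) ?_
    · rcases lt_trichotomy r m with h | h | h
      · simp [(key r hr q hq h hmq).1]
      · simp [h]
      · simp [(key p hp r hr hpm h).2]
    · rw [hΔ.card_eq]
      exact Finset.card_le_three
  · rintro (rfl | h | h)
    · refine ⟨SimpleGraph.is3Clique_triple_iff.2 ⟨axm, axy, amy⟩, fun p hp => ?_⟩
      simp only [Finset.mem_insert, Finset.mem_singleton] at hp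
      rcases hp with rfl | rfl | rfl
      · exact ⟨le_rfl, (hxm.trans hmy).le⟩
      · exact ⟨hxm.le, hmy.le⟩
      · exact ⟨(hxm.trans hmy).le, le_rfl⟩
    · exact ⟨h.1, fun p hp => ⟨(h.2 p hp).1, (h.2 p hp).2.trans hmy.le⟩⟩
    · exact ⟨h.1, fun p hp => ⟨hxm.le.trans (h.2 p hp).1, (h.2 p hp).2⟩⟩

theorem strictMono_of_covBy (hv : ∀ n, v n ⋖ v (n + 1)) : StrictMono v :=
  strictMono_nat_of_lt_succ fun n => (hv n).lt

theorem exists_eq_of_covBy (hv : ∀ n, v n ⋖ v (n + 1)) {k j : ℕ} {p : α} (h1 : v k ≤ p)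
    (h2 : p ≤ v j) : ∃ m, k ≤ m ∧ m ≤ j ∧ p = v m := by
  induction j with
  | zero =>
    have := (strictMono_of_covBy hv).le_iff_le.1 (h1.trans h2)
    have hk : k = 0 := by omega
    subst hk
    exact ⟨0, le_rfl, le_rfl, le_antisymm h2 h1⟩
  | succ j ih =>
    by_cases h : p ≤ v j
    · obtain ⟨m, hm⟩ := ih h
      exact ⟨m, hm.1, by omega, hm.2.2⟩
    · have hp : p = v (j + 1) := by
        by_contra hne
        exact (hv j).2 (not_le.1 h) (lt_of_le_of_ne h2 hne)
      refine ⟨j + 1, ?_, le_rfl, hp⟩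
      exact (strictMono_of_covBy hv).le_iff_le.1 (h1.trans h2)

/-- The number of tuples for the walk with interior vertices `v 1, …, v n`, avoiding `F`. -/
noncomputable def walkCount (hfin : ∀ n, (G.neighborSet (v n)).Finite) (n : ℕ)
    (F : Set (Finset α)) : ℕ :=
  tupleCount (fun n => (finite_cliquesAt (hfin n)).toFinset) n F

/-- The edge `v k v j` is the long side of a triangle with third vertex `v m`. -/
theorem exists_triangle_under (hG : IsMaximalNoncrossing G) (hv : ∀ n, v n ⋖ v (n + 1))
    (hadj : ∀ n, G.Adj (v n) (v (n + 1))) (hfin : ∀ n, (G.neighborSet (v n)).Finite) {k j : ℕ}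
    (hkj : k + 1 < j) (h : G.Adj (v k) (v j)) :
    ∃ m, k < m ∧ m < j ∧ G.Adj (v k) (v m) ∧ G.Adj (v m) (v j) := by
  have hmono := strictMono_of_covBy hv
  obtain ⟨p, hp, hc, ha⟩ := hG.exists_prev (hfin k) h (hadj k)
    (Or.inl ⟨hmono (Nat.lt_succ_self k), hmono hkj⟩)
  have hlt := hmono (show k < j by omega)
  have hkp : v k < p ∧ p < v j := by unfold Cyc at hc; grind
  obtain ⟨m, h1, h2, rfl⟩ := exists_eq_of_covBy hv hkp.1.le hkp.2.le
  exact ⟨m, hmono.lt_iff_lt.1 hkp.1, hmono.lt_iff_lt.1 hkp.2, hp, ha⟩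

theorem disjoint_trianglesIn {x m y : α} {Δ : Finset α} (h1 : Δ ∈ trianglesIn G x m)
    (h2 : Δ ∈ trianglesIn G m y) : False := by
  have h : Δ ⊆ {m} := fun p hp =>
    Finset.mem_singleton.2 (le_antisymm (h1.2 p hp).2 (h2.2 p hp).1)
  have := Finset.card_le_card h
  rw [h1.1.card_eq] at this
  simp at this

open Classical in
/-- The triangles at the vertices under an edge are exactly those under the edge, and they can be
chosen in only one way. -/
theorem walkCount_edge (hG : IsMaximalNoncrossing G) (hv : ∀ n, v n ⋖ v (n + 1))
    (hadj : ∀ n, G.Adj (v n) (v (n + 1))) (hfin : ∀ n, (G.neighborSet (v n)).Finite) {k d : ℕ}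
    (h : G.Adj (v k) (v (k + d + 1))) (F : Set (Finset α)) :
    walkCount hfin (k + d) F = if Disjoint F (trianglesIn G (v k) (v (k + d + 1))) then
      walkCount hfin k (F ∪ trianglesIn G (v k) (v (k + d + 1))) else 0 := by
  have hmono := strictMono_of_covBy hv
  -- The `d` vertices strictly below the edge use up all triangles under it, leaving `v 1, …, v k`
  -- to avoid these as well as `F`.
  induction d using Nat.strong_induction_on generalizing k F with
  | _ d ih =>
  by_cases hd : d = 0
  · subst hd
    have : trianglesIn G (v k) (v (k + 0 + 1)) = ∅ := by
      refine Set.eq_empty_of_forall_notMem fun Δ hΔ => ?_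
      have hs : Δ ⊆ {v k, v (k + 1)} := fun p hp => by
        by_contra hne
        simp only [Finset.mem_insert, Finset.mem_singleton, not_or] at hne
        exact (hv k).2 (lt_of_le_of_ne (hΔ.2 p hp).1 (Ne.symm hne.1))
          (lt_of_le_of_ne (hΔ.2 p hp).2 hne.2)
      have := Finset.card_le_card hs
      rw [hΔ.1.card_eq] at this
      have := this.trans Finset.card_le_two
      omega
    simp [this]
  · obtain ⟨m, hkm, hmj, akm, amj⟩ :=
      exists_triangle_under hG hv hadj hfin (show k + 1 < k + d + 1 by omega) h
    obtain ⟨a, rfl⟩ : ∃ a, m = k + a + 1 := ⟨m - k - 1, by omega⟩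
    obtain ⟨b, rfl⟩ : ∃ b, d = a + 1 + b := ⟨d - a - 1, by omega⟩
    have e1 : k + (a + 1 + b) = k + a + 1 + b := by omega
    rw [e1] at h hmj amj ⊢
    set D₁ := trianglesIn G (v k) (v (k + a + 1)) with hD₁
    set D₂ := trianglesIn G (v (k + a + 1)) (v (k + a + 1 + b + 1)) with hD₂
    set Δ₀ : Finset α := {v k, v (k + a + 1), v (k + a + 1 + b + 1)} with hΔ₀
    have hDeq := trianglesIn_eq hG (hmono hkm) (hmono hmj) akm amj h
    rw [← hD₁, ← hD₂, ← hΔ₀] at hDeq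
    rw [hDeq, ih b (by omega) amj F, ← hD₂]
    -- Once `D₂` is used up, the middle vertex must take `Δ₀`: its triangles all lie under the long
    -- edge, and taking one from `D₁` makes the count for the left part zero by induction.
    have step : walkCount hfin (k + a + 1) (F ∪ D₂) =
        if Δ₀ ∉ F ∧ Disjoint F D₁ then walkCount hfin k (F ∪ insert Δ₀ (D₁ ∪ D₂)) else 0 := by
      have hn₁ : Δ₀ ∉ D₁ := fun hm => not_lt.2 (hm.2 (v (k + a + 1 + b + 1)) (by simp [hΔ₀])).2
        (hmono (by omega))
      have hn₂ : Δ₀ ∉ D₂ := fun hm => not_lt.2 (hm.2 (v k) (by simp [hΔ₀])).1 (hmono (by omega))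
      rw [walkCount, tupleCount]
      have hterm : ∀ Δ ∈ ((finite_cliquesAt (hfin (k + a + 1))).toFinset).filter (· ∉ F ∪ D₂),
          tupleCount (fun n => (finite_cliquesAt (hfin n)).toFinset) (k + a) (insert Δ (F ∪ D₂)) =
          if Δ = Δ₀ then (if Disjoint F D₁ then walkCount hfin k (F ∪ insert Δ₀ (D₁ ∪ D₂)) else 0)
          else 0 := by
        intro Δ hΔ
        simp only [Finset.mem_filter, Set.Finite.mem_toFinset, Set.mem_union, not_or] at hΔ
        have := ih a (by omega) akm (insert Δ (F ∪ D₂))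
        rw [walkCount] at this
        rw [this, ← hD₁]
        have hD₂₁ : Disjoint D₂ D₁ :=
          Set.disjoint_left.2 fun X h2 h1 => disjoint_trianglesIn h1 h2
        by_cases hΔΔ : Δ = Δ₀
        · subst hΔΔ
          rw [if_pos rfl]
          have : Disjoint (insert Δ₀ (F ∪ D₂)) D₁ ↔ Disjoint F D₁ := by
            rw [Set.disjoint_insert_left, Set.disjoint_union_left]
            tauto
          simp only [this]
          congr 2
          ext X
          simp only [Set.mem_union, Set.mem_insert_iff]
          tauto
        · rw [if_neg hΔΔ, if_neg]
          intro hdis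
          have hin := mem_trianglesIn_of_between hG h (hmono hkm) (hmono hmj) hΔ.1
          rw [hDeq] at hin
          rcases hin with hin | hin | hin
          · exact hΔΔ hin
          · exact Set.disjoint_left.1 hdis (Set.mem_insert _ _) hin
          · exact hΔ.2.2 hin
      refine (Finset.sum_congr (by ext; simp only [Finset.mem_filter]) hterm).trans ?_
      rw [Finset.sum_ite_eq']
      have hmem : Δ₀ ∈ cliquesAt G (v (k + a + 1)) :=
        ⟨SimpleGraph.is3Clique_triple_iff.2 ⟨akm, h, amj⟩, by simp [hΔ₀]⟩
      simp only [Finset.mem_filter, Set.Finite.mem_toFinset, hmem, true_and, Set.mem_union, hn₂,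
        or_false]
      split_ifs <;> tauto
    rw [step]
    have : Disjoint F (insert Δ₀ (D₁ ∪ D₂)) ↔ Disjoint F D₂ ∧ Δ₀ ∉ F ∧ Disjoint F D₁ := by
      rw [Set.disjoint_insert_right, Set.disjoint_union_right]
      tauto
    simp only [this, ite_and]

/-- The number of tuples for the walk from `v 0` to `v j`. -/
noncomputable def walkNumber (hfin : ∀ n, (G.neighborSet (v n)).Finite) (j : ℕ) : ℕ :=
  if j = 0 then 0 else walkCount hfin (j - 1) ∅

/-- A triangle at one of `v 1, …, v n` has a vertex before `v (n + 1)`, so nothing relevant is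
forbidden. -/
theorem walkCount_trianglesIn (hv : ∀ n, v n ⋖ v (n + 1))
    (hfin : ∀ n, (G.neighborSet (v n)).Finite) (n : ℕ) (y : α) :
    walkCount hfin n (trianglesIn G (v (n + 1)) y) = walkCount hfin n ∅ := by
  refine tupleCount_congr fun l _ hl Δ hΔ => ?_
  rw [Set.Finite.mem_toFinset] at hΔ
  simp only [Set.mem_empty_iff_false, iff_false]
  intro h
  exact not_lt.2 (h.2 _ hΔ.2).1 (strictMono_of_covBy hv (by omega))

/-- Beyond `v k` the choices are forced and avoid `Δ`, so `Δ` can only be used at `v k`; such tuples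
leave `v 1, …, v (k - 1)` free. For `k = 0` there is no such place, matching `walkNumber hfin 0 =
0`. -/
theorem walkCount_eq_add (hG : IsMaximalNoncrossing G) (hv : ∀ n, v n ⋖ v (n + 1))
    (hadj : ∀ n, G.Adj (v n) (v (n + 1))) (hfin : ∀ n, (G.neighborSet (v n)).Finite) {k d : ℕ}
    (h : G.Adj (v k) (v (k + d + 1))) {Δ : Finset α} (hΔ : Δ ∈ cliquesAt G (v k))
    (hΔD : Δ ∉ trianglesIn G (v k) (v (k + d + 1))) (hl : ∀ l < k, v l ∉ Δ) :
    walkCount hfin (k + d) ∅ = walkCount hfin (k + d) {Δ} + walkNumber hfin k := by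
  rw [walkCount_edge hG hv hadj hfin h, walkCount_edge hG hv hadj hfin h,
    if_pos (Set.empty_disjoint _), if_pos (Set.disjoint_singleton_left.2 hΔD), Set.empty_union,
    Set.singleton_union]
  rcases k with _ | k
  · simp [walkNumber, walkCount, tupleCount]
  · rw [walkNumber, if_neg (by omega), Nat.add_sub_cancel,
      ← walkCount_trianglesIn hv hfin k (v (k + 1 + d + 1))]
    refine tupleCount_insert (by simpa using hΔ) hΔD fun l _ h2 hmem => ?_
    rw [Set.Finite.mem_toFinset] at hmem
    exact hl l (by omega) hmem.2

/-- Walks to `v k` reduce to choices at `v 1, …, v m` avoiding the triangles under `v m v k`. Either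
the big triangle is not used at `v m`, which leaves the count for `v j`, or it is, which leaves the
count for `v m`. In a walk to `v j` that triangle is always used, hence the zero. -/
theorem walkNumber_add (hG : IsMaximalNoncrossing G) (hv : ∀ n, v n ⋖ v (n + 1))
    (hadj : ∀ n, G.Adj (v n) (v (n + 1))) (hfin : ∀ n, (G.neighborSet (v n)).Finite)
    {m k j : ℕ} (hmk : m < k) (hkj : k < j) (amk : G.Adj (v m) (v k)) (akj : G.Adj (v k) (v j))
    (amj : G.Adj (v m) (v j)) :
    walkNumber hfin k = walkNumber hfin j + walkNumber hfin m ∧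
      walkCount hfin (j - 1) {{v m, v k, v j}} = 0 := by
  classical
  have hmono := strictMono_of_covBy hv
  obtain ⟨a, rfl⟩ : ∃ a, k = m + a + 1 := ⟨k - m - 1, by omega⟩
  obtain ⟨b, rfl⟩ : ∃ b, j = m + b + 1 := ⟨j - m - 1, by omega⟩
  have hDeq := trianglesIn_eq hG (hmono hmk) (hmono hkj) amk akj amj
  have hΔk : ({v m, v (m + a + 1), v (m + b + 1)} : Finset α) ∉
      trianglesIn G (v m) (v (m + a + 1)) := fun h =>
    not_lt.2 (h.2 (v (m + b + 1)) (by simp)).2 (hmono hkj)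
  refine ⟨?_, ?_⟩
  · have h1 := walkCount_edge hG hv hadj hfin amk ∅
    have h2 := walkCount_edge hG hv hadj hfin amj ∅
    rw [if_pos (Set.empty_disjoint _), Set.empty_union] at h1 h2
    have e1 : walkNumber hfin (m + a + 1) = walkCount hfin (m + a) ∅ := by simp [walkNumber]
    have e2 : walkNumber hfin (m + b + 1) = walkCount hfin (m + b) ∅ := by simp [walkNumber]
    rw [e1, e2, h1, h2]
    rcases m with _ | m
    · simp [walkNumber, walkCount, tupleCount]
    · have e3 : walkNumber hfin (m + 1) = walkCount hfin m ∅ := by simp [walkNumber]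
      rw [e3, ← walkCount_trianglesIn hv hfin m (v (m + 1 + a + 1))]
      have := tupleCount_insert (S := fun n => (finite_cliquesAt (hfin n)).toFinset) (n := m)
        (F := trianglesIn G (v (m + 1)) (v (m + 1 + a + 1)))
        (Δ := {v (m + 1), v (m + 1 + a + 1), v (m + 1 + b + 1)})
        (by simpa using ⟨SimpleGraph.is3Clique_triple_iff.2 ⟨amk, amj, akj⟩, by simp⟩) hΔk
        (fun l h1 h2 hmem => by
          rw [Set.Finite.mem_toFinset] at hmem
          have := hmem.2
          simp only [Finset.mem_insert, Finset.mem_singleton, hmono.injective.eq_iff] at this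
          omega)
      rw [walkCount, this, walkCount, walkCount]
      congr 1
      refine tupleCount_congr fun l h1 h2 Δ hΔ => ?_
      rw [Set.Finite.mem_toFinset] at hΔ
      rw [hDeq, Set.mem_insert_iff, Set.mem_insert_iff, Set.mem_union]
      have : Δ ∉ trianglesIn G (v (m + 1 + a + 1)) (v (m + 1 + b + 1)) := fun h =>
        not_lt.2 (h.2 _ hΔ.2).1 (hmono (by omega))
      tauto
  · rw [Nat.add_sub_cancel, walkCount_edge hG hv hadj hfin amj, if_neg]
    rw [Set.disjoint_singleton_left, not_not, hDeq]
    exact Set.mem_insert _ _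

theorem between_of_cyc (hv : ∀ n, v n ⋖ v (n + 1)) {l n : ℕ} {q : α} (hl : l < n)
    (hc : Cyc (v n) (v l) q) : ∃ k, k < n ∧ q = v k := by
  have h1 := strictMono_of_covBy hv hl
  have h2 : v l < q ∧ q < v n := by unfold Cyc at hc; grind
  obtain ⟨k, _, hk, rfl⟩ := exists_eq_of_covBy hv h2.1.le h2.2.le
  exact ⟨k, (strictMono_of_covBy hv).lt_iff_lt.1 h2.2, rfl⟩

/-- The walk numbers satisfy the recurrence given by the numbers of triangles. -/
theorem walkNumber_recurrence (hG : IsMaximalNoncrossing G) (hv : ∀ n, v n ⋖ v (n + 1))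
    (hadj : ∀ n, G.Adj (v n) (v (n + 1))) (hfin : ∀ n, (G.neighborSet (v n)).Finite) (n : ℕ) :
    (walkNumber hfin (n + 2) : ℤ) + walkNumber hfin n =
      (fan G (hfin (n + 1))).card * walkNumber hfin (n + 1) := by
  classical
  have hmono := strictMono_of_covBy hv
  have e1 : ∀ m, walkNumber hfin (m + 1) = walkCount hfin m ∅ := fun m => by simp [walkNumber]
  have e2 : (walkCount hfin (n + 1) ∅ : ℤ) =
      ∑ pq ∈ fan G (hfin (n + 1)), (walkCount hfin n {{v (n + 1), pq.1, pq.2}} : ℤ) := by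
    rw [← sum_cliquesAt (hfin (n + 1)) (fun Δ => (walkCount hfin n {Δ} : ℤ)), walkCount, tupleCount]
    push_cast
    refine Finset.sum_congr (by ext; simp) fun Δ _ => ?_
    simp [walkCount]
  -- Minus the walk number on `v 0, …, v n`, zero elsewhere. The tuples avoiding a triangle of the
  -- fan then number the full count minus a difference of `h`, and these differences sum to
  -- `walkNumber hfin n`.
  let h : α → ℤ := fun p =>
    if hp : ∃ k, k < n + 1 ∧ p = v k then - (walkNumber hfin hp.choose : ℤ) else 0
  have h_pos : ∀ k, k < n + 1 → h (v k) = - (walkNumber hfin k : ℤ) := by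
    intro k hk
    have hp : ∃ k', k' < n + 1 ∧ v k = v k' := ⟨k, hk, rfl⟩
    have : hp.choose = k := (hmono.injective hp.choose_spec.2).symm
    simp only [h, dif_pos hp, this]
  have h_neg : ∀ p, (¬ ∃ k, k < n + 1 ∧ p = v k) → h p = 0 := fun p hp => dif_neg hp
  have hsum := hG.sum_fan (hfin (n + 1)) (hv n) (hv (n + 1)) (hadj n).symm (hadj (n + 1)) h
  rw [h_pos n (by omega), h_neg (v (n + 2)) (by
    rintro ⟨k, hk, hkn⟩
    have := hmono.injective hkn
    omega)] at hsum
  have hterm : ∀ pq ∈ fan G (hfin (n + 1)),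
      (walkCount hfin n {{v (n + 1), pq.1, pq.2}} : ℤ) =
        walkNumber hfin (n + 1) - (h pq.1 - h pq.2) := by
    rintro ⟨p, q⟩ hpq
    obtain ⟨hp, hq, hc, ha⟩ := (mem_fan (hfin (n + 1))).1 hpq
    simp only at hp hq hc ha ⊢
    -- In the order from `v (n + 1)` the earlier walk vertices come last, so if `p` is one of them,
    -- so is `q`. Three cases remain: both, only `q`, neither.
    by_cases hqv : ∃ k, k < n + 1 ∧ q = v k
    · obtain ⟨k, hk, rfl⟩ := hqv
      rw [h_pos k hk]
      by_cases hpv : ∃ m, m < n + 1 ∧ p = v m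
      · obtain ⟨m, hm, rfl⟩ := hpv
        rw [h_pos m hm]
        have hmk : m < k := by
          have h1 := hmono hm
          have h2 := hmono hk
          refine hmono.lt_iff_lt.1 ?_
          unfold Cyc at hc; grind
        have := walkNumber_add hG hv hadj hfin hmk hk ha hq.symm hp.symm
        rw [Nat.add_sub_cancel, show ({v m, v k, v (n + 1)} : Finset α) =
          {v (n + 1), v m, v k} by ext; simp; tauto] at this
        rw [this.1, this.2]
        push_cast; ring
      · rw [h_neg p hpv]
        obtain ⟨d, rfl⟩ : ∃ d, n = k + d := ⟨n - k, by omega⟩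
        have hpk : ∀ l ≤ k + d, p ≠ v l := fun l hl hpl => hpv ⟨l, by omega, hpl⟩
        have := walkCount_eq_add hG hv hadj hfin hq.symm
          (Δ := {v (k + d + 1), p, v k})
          ⟨SimpleGraph.is3Clique_triple_iff.2 ⟨hp, hq, ha⟩, by simp⟩ (fun hmem => by
            have hb := hmem.2 p (by simp)
            obtain ⟨l, h1, h2, hl⟩ := exists_eq_of_covBy hv hb.1 hb.2
            rcases Nat.lt_or_ge l (k + d + 1) with h3 | h3
            · exact hpk l (by omega) hl
            · have : l = k + d + 1 := by omega
              exact hp.ne' (this ▸ hl))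
          (fun l hl hmem => by
            simp only [Finset.mem_insert, Finset.mem_singleton, hmono.injective.eq_iff] at hmem
            rcases hmem with h1 | h1 | h1
            · omega
            · exact hpk l (by omega) h1.symm
            · omega)
        rw [e1, this]
        push_cast; ring
    · rw [h_neg q hqv, h_neg p, e1]
      · simp only [sub_zero, Nat.cast_inj]
        refine tupleCount_congr fun l h1 h2 Δ hΔ => ?_
        rw [Set.Finite.mem_toFinset] at hΔ
        simp only [Set.mem_singleton_iff, Set.mem_empty_iff_false, iff_false]
        rintro rfl
        have := hΔ.2
        simp only [Finset.mem_insert, Finset.mem_singleton, hmono.injective.eq_iff] at this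
        rcases this with h3 | h3 | h3
        · omega
        · subst h3
          exact hqv (between_of_cyc hv (by omega) hc)
        · exact hqv ⟨l, by omega, h3.symm⟩
      · rintro ⟨m, hm, rfl⟩
        exact hqv (between_of_cyc hv hm hc)
  rw [e1 (n + 1), e2, Finset.sum_congr rfl hterm, Finset.sum_sub_distrib, hsum]
  simp

end Walk

end Strip

/-! ### Infinite friezes with a given quiddity sequence -/

namespace Strip

/-- Pairs of consecutive terms of a solution of `x (j + 1) = a j * x j - x (j - 1)`. -/
def solutionAux (a : ℤ → ℤ) (x₀ x₁ : ℤ) : ℤ → ℤ × ℤ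
  | Int.ofNat n => n.rec (x₀, x₁) fun k z => (z.2, a (k + 1) * z.2 - z.1)
  | Int.negSucc n => (n + 1).rec (x₀, x₁) fun k z => (a (-k) * z.1 - z.2, z.1)

theorem solutionAux_succ (a : ℤ → ℤ) (x₀ x₁ j : ℤ) : solutionAux a x₀ x₁ (j + 1) =
    ((solutionAux a x₀ x₁ j).2,
      a (j + 1) * (solutionAux a x₀ x₁ j).2 - (solutionAux a x₀ x₁ j).1) := by
  rcases j with n | n
  · rfl
  · rcases n with _ | n
    · simp [solutionAux]
    · have : Int.negSucc (n + 1) + 1 = Int.negSucc n := by omega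
      rw [this]
      have h : solutionAux a x₀ x₁ (Int.negSucc (n + 1)) =
        (a (-(n + 1 : ℕ)) * (solutionAux a x₀ x₁ (Int.negSucc n)).1 -
          (solutionAux a x₀ x₁ (Int.negSucc n)).2, (solutionAux a x₀ x₁ (Int.negSucc n)).1) := rfl
      rw [h, Int.negSucc_eq]
      push_cast
      ext <;> simp

theorem exists_solution (a : ℤ → ℤ) (x₀ x₁ : ℤ) :
    ∃ x : ℤ → ℤ, x 0 = x₀ ∧ x 1 = x₁ ∧ ∀ j, x (j + 1) = a j * x j - x (j - 1) := by
  refine ⟨fun j => (solutionAux a x₀ x₁ j).1, rfl, rfl, fun j => ?_⟩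
  obtain ⟨k, rfl⟩ : ∃ k, j = k + 1 := ⟨j - 1, by ring⟩
  simp only [solutionAux_succ, add_sub_cancel_right]

/-- An antisymmetric unimodular array with prescribed quiddity sequence, without positivity. -/
theorem exists_unimodular (a : ℤ → ℤ) : ∃ t : ℤ → ℤ → ℤ, (∀ i j, t i j = - t j i) ∧
    (∀ i, t i (i + 1) = 1) ∧
    (∀ i j, t i j * t (i + 1) (j + 1) - t i (j + 1) * t (i + 1) j = 1) ∧
    ∀ i j, t i (j + 1) = a j * t i j - t i (j - 1) := by
  obtain ⟨u, hu0, hu1, hu⟩ := exists_solution a 1 0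
  obtain ⟨w, hw0, hw1, hw⟩ := exists_solution a 0 1
  -- The discrete Wronskian is constant; each unimodular relation for `u i * w j - w i * u j` is a
  -- product of two Wronskians.
  have h1 : ∀ i, u i * w (i + 1) - w i * u (i + 1) = 1 := by
    intro i
    induction i with
    | zero => simp [hu0, hw1, hw0]
    | succ n ih =>
      rw [hu (n + 1), hw (n + 1)]
      simp only [add_sub_cancel_right]
      linarith
    | pred n ih =>
      rw [hu, hw] at ih
      simp only [sub_add_cancel]
      linarith
  refine ⟨fun i j => u i * w j - w i * u j, fun i j => by ring, h1, fun i j => ?_, fun i j => ?_⟩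
  · calc _ = (u i * w (i + 1) - w i * u (i + 1)) * (u j * w (j + 1) - w j * u (j + 1)) := by ring
      _ = 1 := by rw [h1, h1]; ring
  · simp only [hu j, hw j]; ring

/-- Descend in `i` from `j - 1`, where the claim defines the quiddity. The difference of two
neighbouring unimodular relations gives the step after cancelling `t (i + 1) j`, nonzero by
positivity. -/
theorem IsInfiniteFrieze.recurrence {t : ℤ → ℤ → ℤ} (h : IsInfiniteFrieze t) {i j : ℤ}
    (hij : i < j) : t i (j + 1) = quiddity t j * t i j - t i (j - 1) := by
  have key : ∀ n : ℕ, t (j - 1 - n) (j + 1) = quiddity t j * t (j - 1 - n) j -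
      t (j - 1 - n) (j - 1) := by
    intro n
    induction n with
    | zero =>
      have := h.one (j - 1)
      simp only [sub_add_cancel] at this
      simp [quiddity, h.diag, this]
    | succ n ih =>
      set i := j - 1 - ((n + 1 : ℕ) : ℤ) with hi
      have hi' : j - 1 - (n : ℤ) = i + 1 := by rw [hi]; push_cast; ring
      rw [hi'] at ih
      have u1 := h.unimodular i (j - 1)
      have u2 := h.unimodular i j
      simp only [sub_add_cancel] at u1
      have hpos := h.pos (i + 1) j (by omega)
      have hne : t (i + 1) j ≠ 0 := by omega
      apply mul_left_cancel₀ hne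
      rw [ih] at u2
      linear_combination u1 - u2
  have := key (j - 1 - i).toNat
  rwa [Int.toNat_of_nonneg (by omega), show j - 1 - (j - 1 - i) = i by ring] at this

/-- Two solutions of the recurrence with the same initial values agree. -/
theorem eq_of_recurrence {a x y : ℤ → ℤ} {i : ℤ} (h0 : x i = y i) (h1 : x (i + 1) = y (i + 1))
    (hx : ∀ j, i < j → x (j + 1) = a j * x j - x (j - 1))
    (hy : ∀ j, i < j → y (j + 1) = a j * y j - y (j - 1)) {j : ℤ} (hij : i ≤ j) : x j = y j := by
  have key : ∀ n : ℕ, x (i + n) = y (i + n) ∧ x (i + n + 1) = y (i + n + 1) := by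
    intro n
    induction n with
    | zero => simpa using ⟨h0, h1⟩
    | succ n ih =>
      push_cast
      rw [← add_assoc]
      refine ⟨ih.2, ?_⟩
      rw [hx _ (by omega), hy _ (by omega), add_sub_cancel_right, ih.1, ih.2]
  have := (key (j - i).toNat).1
  rwa [Int.toNat_of_nonneg (by omega), add_sub_cancel] at this

/-- A frieze with quiddity sequence `a` exists and is unique as soon as the solutions of the
associated recurrences are positive. -/
theorem existsUnique_frieze {a : ℤ → ℤ} {f : ℤ → ℤ → ℤ} (f0 : ∀ i, f i i = 0)
    (f1 : ∀ i, f i (i + 1) = 1) (fpos : ∀ i j, i < j → 1 ≤ f i j)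
    (frec : ∀ i j, i < j → f i (j + 1) = a j * f i j - f i (j - 1)) :
    (∃! t : ℤ → ℤ → ℤ, IsInfiniteFrieze t ∧ ∀ i, quiddity t i = a i) ∧
      ∀ t : ℤ → ℤ → ℤ, IsInfiniteFrieze t → (∀ i, quiddity t i = a i) →
        ∀ i j, i ≤ j → t i j = f i j := by
  have huniq : ∀ t : ℤ → ℤ → ℤ, IsInfiniteFrieze t → (∀ i, quiddity t i = a i) →
      ∀ i j, i ≤ j → t i j = f i j := by
    intro t ht hq i j hij
    refine eq_of_recurrence (a := a) (by rw [ht.diag, f0]) (by rw [ht.one, f1]) (fun j hj => ?_)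
      (frec i) hij
    rw [ht.recurrence hj, hq]
  refine ⟨?_, huniq⟩
  obtain ⟨t, hanti, hone, huni, hrec⟩ := exists_unimodular a
  have hdiag : ∀ i, t i i = 0 := fun i => by have := hanti i i; omega
  have htf : ∀ i j, i ≤ j → t i j = f i j := fun i j hij =>
    eq_of_recurrence (a := a) (by rw [hdiag, f0]) (by rw [hone, f1]) (fun j _ => hrec i j)
      (frec i) hij
  refine ⟨t, ⟨⟨hdiag, fun i j hij => ?_, hone, hanti, huni⟩, fun i => ?_⟩, ?_⟩
  · rw [htf i j hij.le]
    exact fpos i j hij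
  · have := hone (i - 1)
    rw [sub_add_cancel] at this
    rw [quiddity, hrec, hdiag, this]
    ring
  · rintro s ⟨hs, hq⟩
    funext i j
    rcases le_total i j with h | h
    · rw [huniq s hs hq i j h, htf i j h]
    · rw [hs.antisymm, hanti, huniq s hs hq j i h, htf j i h]

end Strip

/-! ### Triangulations of the strip -/

namespace Strip

variable {M₂ : Set ℤ} {T : Set (Arc M₂)}

/-- Boundary segments cross nothing, as no marked point lies between their ends, and a chord crossed
by no edge could be added to `T`. -/
theorem isMaximalNoncrossing_edgeGraph (hT : IsTriangulation T) :
    IsMaximalNoncrossing (edgeGraph T) := by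
  constructor
  · intro a b c d hab hcd h1 h2 h3
    have key : ∀ {x y : MarkedPoint M₂}, (edgeGraph T).Adj x y → x < y →
        (∃ z, x < z ∧ z < y) → ∃ α ∈ T, α.fst = x ∧ α.snd = y := by
      rintro x y (⟨α, hα, h | h⟩ | h | h) hxy ⟨z, hz1, hz2⟩
      · exact ⟨α, hα, h⟩
      · have := α.lt
        rw [h.1, h.2] at this
        exact absurd hxy this.asymm
      · exact absurd hz2 (h.2 hz1)
      · exact absurd hxy h.lt.asymm
    obtain ⟨α, hα, rfl, rfl⟩ := key hab (h1.trans h2) ⟨c, h1, h2⟩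
    obtain ⟨β, hβ, rfl, rfl⟩ := key hcd (h2.trans h3) ⟨α.snd, h2, h3⟩
    have hne : α ≠ β := by rintro rfl; exact lt_irrefl _ h1
    exact hT.prop hα hβ hne (Or.inl ⟨h1, h2, h3⟩)
  · intro p q hpq h
    by_cases hcov : p ⋖ q
    · exact Or.inr (Or.inl hcov)
    let α : Arc M₂ := ⟨p, q, hpq, hcov⟩
    have hcomp : ∀ β ∈ T, α.Compatible β ∧ β.Compatible α := by
      intro β hβ
      have hadj : (edgeGraph T).Adj β.fst β.snd := Or.inl ⟨β, hβ, Or.inl ⟨rfl, rfl⟩⟩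
      have h1 : ¬ α.Crosses β := by
        rintro (⟨h1, h2, h3⟩ | ⟨h1, h2, h3⟩)
        · exact h _ _ hadj h1 h2 (Or.inr h3)
        · exact h _ _ hadj.symm h2 h3 (Or.inl h1)
      exact ⟨h1, fun h2 => h1 h2.symm⟩
    have hmem : α ∈ T := by
      refine hT.le_of_ge (y := insert α T) ?_ (Set.subset_insert _ _) (Set.mem_insert _ _)
      refine hT.prop.insert fun β hβ _ => hcomp β hβ
    exact Or.inl ⟨α, hmem, Or.inl ⟨rfl, rfl⟩⟩

theorem lower_covBy (i : ℤ) : (lower i : MarkedPoint M₂) ⋖ lower (i + 1) := by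
  constructor
  · exact Sum.Lex.inl_lt_inl_iff.2 (by omega)
  · intro c
    obtain ⟨c, rfl⟩ := toLex.surjective c
    rcases c with c | c
    · intro h1 h2
      have h1' := Sum.Lex.inl_lt_inl_iff.1 h1
      have h2' := Sum.Lex.inl_lt_inl_iff.1 h2
      omega
    · intro _ h2
      exact Sum.Lex.not_inr_lt_inl h2

theorem finite_neighborSet_lower (hadm : IsAdmissible T) (i : ℤ) :
    ((edgeGraph T).neighborSet (lower i)).Finite := by
  refine (((hadm i).image Arc.fst).union (((hadm i).image Arc.snd).union
    (Set.toFinite {lower (i + 1), lower (i - 1)}))).subset ?_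
  rintro q (⟨α, hα, ⟨h1, h2⟩ | ⟨h1, h2⟩⟩ | h | h)
  · exact Or.inr (Or.inl ⟨α, ⟨hα, Or.inl h1⟩, h2⟩)
  · exact Or.inl ⟨α, ⟨hα, Or.inr h2⟩, h1⟩
  · exact Or.inr (Or.inr (Or.inl (h.unique_right (lower_covBy i))))
  · have := lower_covBy (M₂ := M₂) (i - 1)
    rw [sub_add_cancel] at this
    exact Or.inr (Or.inr (Or.inr (h.unique_left this)))

theorem numTriangles_eq (hadm : IsAdmissible T) (i : ℤ) : numTriangles T i =
    (fan (edgeGraph T) (finite_neighborSet_lower hadm i)).card :=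
  ncard_cliquesAt _

theorem lower_lt {i j : ℤ} (h : i < j) : (lower i : MarkedPoint M₂) < lower j :=
  Sum.Lex.inl_lt_inl_iff.2 h

theorem lower_pred_covBy (i : ℤ) : (lower (i - 1) : MarkedPoint M₂) ⋖ lower i := by
  simpa using lower_covBy (M₂ := M₂) (i - 1)

/-- Two consecutive labelled lower points make the whole fan at the second one labelled, including
the next lower point. -/
theorem isLabelled_lower (hT : IsTriangulation T) (hadm : IsAdmissible T) {i j : ℤ}
    (hij : i ≤ j) : IsLabelled T (lower i) (lower j) := by
  have hG := isMaximalNoncrossing_edgeGraph hT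
  have key : ∀ n : ℕ, IsLabelled T (lower i) (lower (i + n)) ∧
      IsLabelled T (lower i) (lower (i + n + 1)) := by
    intro n
    induction n with
    | zero =>
      refine ⟨⟨0, ?_⟩, 1, ?_⟩
      · simpa using ccLabel_self
      · simpa using ccLabel_of_adj (T := T) (Or.inr (Or.inl (lower_covBy i)))
    | succ n ih =>
      push_cast
      rw [← add_assoc]
      exact ⟨ih.2, IsLabelled.of_adj hG (finite_neighborSet_lower hadm _) (lower_covBy _) ih.2 ih.1
        (Or.inr (Or.inl (lower_covBy _)))⟩
  have := (key (j - i).toNat).1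
  rwa [Int.toNat_of_nonneg (by omega), add_sub_cancel] at this

theorem label_recurrence (hT : IsTriangulation T) (hadm : IsAdmissible T) {i j : ℤ}
    (hij : i < j) : (label T (lower i) (lower (j + 1)) : ℤ) =
      numTriangles T j * label T (lower i) (lower j) - label T (lower i) (lower (j - 1)) := by
  have := label_add_label (isMaximalNoncrossing_edgeGraph hT) (finite_neighborSet_lower hadm j)
    (lower_pred_covBy j) (lower_covBy j) (lower_lt hij) (isLabelled_lower hT hadm hij.le)
    (isLabelled_lower hT hadm (by omega : i ≤ j - 1))
  rw [numTriangles_eq hadm]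
  linarith

theorem BCI_eq_walkNumber (hadm : IsAdmissible T) (i : ℤ) (n : ℕ) : BCI T i (i + n) =
    walkNumber (G := edgeGraph T) (v := fun n : ℕ => lower (i + n))
      (fun n => finite_neighborSet_lower hadm (i + n)) n := by
  rcases n with _ | n
  · simp [BCI, walkNumber]
  · rw [BCI, if_neg (by push_cast; omega), walkNumber, if_neg (by omega), Nat.add_sub_cancel,
      walkCount, ← ncard_tuples]
    have hn : (i + ((n + 1 : ℕ) : ℤ) - i - 1).toNat = n := by omega
    rw [hn, bciTuples]
    congr 1
    ext f
    simp only [Set.mem_ofPred_eq, Set.Finite.mem_toFinset, Set.mem_empty_iff_false,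
      not_false_eq_true, and_true]
    refine and_congr_right fun _ => forall_congr' fun k => ?_
    have : i + 1 + (k : ℤ) = i + ((k + 1 : ℕ) : ℤ) := by push_cast; ring
    rw [this]
    rfl

theorem BCI_recurrence (hT : IsTriangulation T) (hadm : IsAdmissible T) {i j : ℤ}
    (hij : i < j) :
    (BCI T i (j + 1) : ℤ) = numTriangles T j * BCI T i j - BCI T i (j - 1) := by
  obtain ⟨n, rfl⟩ : ∃ n : ℕ, j = i + ((n + 1 : ℕ) : ℤ) := ⟨(j - i - 1).toNat, by omega⟩
  have hv : ∀ n : ℕ, (lower (i + n) : MarkedPoint M₂) ⋖ lower (i + (n + 1 : ℕ)) := fun n => by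
    push_cast
    rw [← add_assoc]
    exact lower_covBy _
  have := walkNumber_recurrence (isMaximalNoncrossing_edgeGraph hT) hv
    (fun n => Or.inr (Or.inl (hv n))) (fun n => finite_neighborSet_lower hadm (i + n)) n
  rw [← BCI_eq_walkNumber hadm, ← BCI_eq_walkNumber hadm, ← BCI_eq_walkNumber hadm,
    ← numTriangles_eq hadm] at this
  have e1 : i + ((n + 1 : ℕ) : ℤ) + 1 = i + ((n + 2 : ℕ) : ℤ) := by push_cast; ring
  have e2 : i + ((n + 1 : ℕ) : ℤ) - 1 = i + (n : ℤ) := by push_cast; ring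
  rw [e1, e2]
  linarith

end Strip

theorem proposition2p8 (M₂ : Set ℤ) (T : Set (Strip.Arc M₂))
    (hT : Strip.IsTriangulation T) (hadm : Strip.IsAdmissible T)
    (hspecial : ∀ u : M₂, ¬ Strip.IsSpecial T (Strip.upper u)) :
    (∃! t : ℤ → ℤ → ℤ, Strip.IsPhi T t) ∧
      ∀ t : ℤ → ℤ → ℤ, Strip.IsPhi T t →
        ∀ i j : ℤ, i ≤ j →
          Strip.CCEq T (Strip.lower i) (Strip.lower j) (t i j) ∧
            t i j = (Strip.BCI T i j : ℤ) := by
  have hG := Strip.isMaximalNoncrossing_edgeGraph hT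
  have l0 : ∀ i : ℤ, (Strip.label T (Strip.lower i) (Strip.lower i) : ℤ) = 0 := fun i => by
    exact_mod_cast Strip.CCLabel.label_eq hG Strip.ccLabel_self
  have l1 : ∀ i : ℤ, (Strip.label T (Strip.lower i) (Strip.lower (i + 1)) : ℤ) = 1 := fun i => by
    exact_mod_cast Strip.CCLabel.label_eq hG
      (Strip.ccLabel_of_adj (Or.inr (Or.inl (Strip.lower_covBy i))))
  have lrec : ∀ i j : ℤ, i < j → _ := fun i j hij => Strip.label_recurrence hT hadm hij
  obtain ⟨hex, heq⟩ := Strip.existsUnique_frieze (a := fun i => (Strip.numTriangles T i : ℤ))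
    (f := fun i j => (Strip.label T (Strip.lower i) (Strip.lower j) : ℤ)) l0 l1
    (fun i j hij => by
      exact_mod_cast Strip.CCLabel.pos hG (Strip.lower_lt hij).ne'
        (Strip.isLabelled_lower hT hadm hij.le).ccLabel) lrec
  refine ⟨hex, fun t ht i j hij => ?_⟩
  have hlab := Strip.isLabelled_lower hT hadm hij
  have htl := heq t ht.1 ht.2 i j hij
  refine ⟨⟨hlab, fun x hx => ?_⟩, ?_⟩
  · rw [htl, Strip.CCLabel.label_eq hG hx]
  · rw [htl]
    refine Strip.eq_of_recurrence (a := fun i => (Strip.numTriangles T i : ℤ))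
      (x := fun j => (Strip.label T (Strip.lower i) (Strip.lower j) : ℤ))
      (y := fun j => (Strip.BCI T i j : ℤ)) ?_ ?_ (lrec i)
      (fun j hj => Strip.BCI_recurrence hT hadm hj) hij
    · simp [l0, Strip.BCI]
    · have := Strip.BCI_eq_walkNumber hadm i 1
      simp only [Nat.cast_one] at this
      simp [l1, this, Strip.walkNumber, Strip.walkCount, Strip.tupleCount]
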